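/- **Setting.** A string term is a finite sequence of letters (from a countably infinite alphabet) and separators $\mathbf 1$; $+$ is concatenation and $\epsilon$ the empty string. The sort of a string is its number of separators. The index $k$ is $>$, $<$ or an integer $n\ge 1$; $(\alpha_1+\mathbf 1+\alpha_2)\times_k\beta=\alpha_1+\beta+\alpha_2$, where $\alpha_1$ has sort $0$ if $k={>}$, $\alpha_2$ has sort $0$ if $k={<}$, and $\alpha_1$ has sort $n-1$ if $k=n$. Given sorts of the atoms, formulas are built with $C/B$, $A\backslash C$, $A\bullet B$, $C\uparrow_k B$, $A\downarrow_k C$, $A\odot_k B$, with sorts $s(A\bullet B)=s(A)+s(B)$, $s(A\backslash C)=s(C)-s(A)$, $s(C/B)=s(C)-s(B)$, $s(A\odot_kB)=s(A)+s(B)-1$, $s(A\downarrow_kC)=s(C)+1-s(A)$, $s(C\uparrow_kB)=s(C)+1-s(B)$; only formulas are considered for which all these are natural numbers, $s(C)\ge s(B)$ in each subformula $C\uparrow_kB$, and the separator named by $k$ exists in strings of sort $s(A)$ (for $A\downarrow_kC$, $A\odot_kB$) or $s(C\uparrow_kB)$. **Natural deduction.** Let $\ast$ be $+$ or a $\times_k$,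 and write $A\backslash_\ast C$, $C/_\ast B$, $A\bullet_\ast B$ for the corresponding connectives ($\backslash,/,\bullet$ for $+$; $\downarrow_k,\uparrow_k,\odot_k$ for $\times_k$). A hypothesis is $\alpha:A$ with $\alpha=p_0+\mathbf 1+\dots+\mathbf 1+p_n$, $n=s(A)$; different hypotheses have different letters. Rules: from $\alpha:A$ and $\gamma:A\backslash_\ast C$ infer $\alpha\ast\gamma:C$; from $\gamma:C/_\ast B$ and $\beta:B$ infer $\gamma\ast\beta:C$; from $\alpha:A$ and $\beta:B$ infer $\alpha\ast\beta:A\bullet_\ast B$; from a proof of $\alpha\ast\gamma:C$ with hypothesis $\alpha:A$ infer $\gamma:A\backslash_\ast C$, withdrawing it; from a proof of $\gamma\ast\beta:C$ with hypothesis $\beta:B$ infer $\gamma:C/_\ast B$, withdrawing it; from $\delta:A\bullet_\ast B$ and a proof of $\gamma_1+(\alpha\ast\beta)+\gamma_2:C$ with hypotheses $\alpha:A$, $\beta:B$ infer $\gamma_1+\delta+\gamma_2:C$, withdrawing them. Each hypothesis is used exactly once. **Proof structures.** A link has a list of premisses and a list of conclusions. Tensor links: $C/_\ast B,\,B\mid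 C$; $\;A,\,A\backslash_\ast C\mid C$; $\;A,\,B\mid A\bullet_\ast B$ (premisses $\mid$ conclusions). Par links: $C\mid C/_\ast B,\,B$; $\;C\mid A,\,A\backslash_\ast C$; $\;A\bullet_\ast B\mid A,\,B$; their main formula is the compound one, and their other conclusions are active. A proof structure is a finite set of formula occurrences with a finite set of such links, each occurrence being used at most once as a premiss and at most once as a conclusion of links. Occurrences that are not a conclusion of a link are its hypotheses, those that are not a premiss of a link are its conclusions; its inputs are the hypotheses and the active conclusions. A natural deduction proof corresponds to a proof structure as follows: a hypothesis corresponds to one occurrence without links; every other rule takes the disjoint union of the proof structures of its subproofs and adds the link of the rule (a tensor link for the elimination rules of $\backslash_\ast$, $/_\ast$ and the introduction rule of $\bullet_\ast$, a par link for the others), joined to the conclusions of the subproofs and to the withdrawn hypotheses, with a new occurrence for the conclusion of the rule, except that $\bullet_\ast$ elimination has the conclusion of its second subproof as its conclusion. A proof structure is a *proof net* if it corresponds to a natural deduction proof. **Abstract proof structures.** A comb has a finite list of premisses, each a vertex or $\mathbf 1$, and one conclusion vertex, which is not among its premisses. The abstract proof structure of a proof structure has the formula occurrences as vertices, with the sorts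 of the formulas; each tensor link for $+$ becomes a comb with its two premisses, and each input $v$ of sort $n$ gets new vertices $p_0,\dots,p_n$ of sort $0$ and a comb with premisses $p_0,\mathbf 1,\dots,\mathbf 1,p_n$ and conclusion $v$. The other links are kept, except that in par links $p_0,\dots,p_n$ replace each active conclusion $v$. The contractions, in which $\ast$ acts on premiss lists with the sorts of the vertices, are: $[+]$: combs $\beta\to u$ and $\alpha_1,u,\alpha_2\to v$ become $\alpha_1,\beta,\alpha_2\to v$. $[\times_k]$: combs $\alpha\to l$, $\beta\to r$ and a tensor link $\times_k$ with premisses $l,r$ and conclusion $v$ become $\alpha\times_k\beta\to v$. $[\backslash],[\downarrow_k]$: a comb $\alpha\ast\beta\to u$ and a par link for $\backslash_\ast$ with premiss $u$, main conclusion $v$ and active conclusion $p_0,\dots,p_n$, where $\alpha=p_0,\mathbf 1,\dots,\mathbf 1,p_n$, become $\beta\to v$. $[/],[\uparrow_k]$: a comb $\gamma\ast\beta\to u$ and a par link for $/_\ast$ with premiss $u$, main conclusion $v$ and active conclusion $p_0,\dots,p_n$, where $\beta=p_0,\mathbf 1,\dots,\mathbf 1,p_n$, become $\gamma\to v$. $[\bullet],[\odot_k]$: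 a comb $\gamma_1,(\alpha\ast\beta),\gamma_2\to v_2$ and a par link for $\bullet_\ast$ with premiss $v_1$, where $\alpha$ and $\beta$ are in the same way the lists of its two active conclusions, become $\gamma_1,v_1,\gamma_2\to v_2$. **Theorem.** A proof structure is a proof net if and only if its abstract proof structure contracts to a single comb. In more detail: (1) Soundness. Every natural deduction proof of $\alpha_1:A_1,\dots,\alpha_n:A_n\vdash\gamma:C$ corresponds to some proof structure, and every proof structure to which it corresponds has the hypotheses $A_1,\dots,A_n$ and the single conclusion $C$, and its abstract proof structure contracts to the comb with conclusion $C$ and list of premisses $\gamma$ (where the letters of $\alpha_i$ are identified with the vertices $p_0,\dots,p_{s(A_i)}$ of the hypothesis $A_i$). (2) Completeness. If the abstract proof structure of a proof structure $P$ contracts to a single comb with list of premisses $\gamma$, then $P$ has a single conclusion $C$, which is the conclusion of the comb, and for every assignment of strings $\alpha_i$ (with pairwise different letters) to the hypotheses $A_i$ of $P$ there is a natural deduction proof of $\alpha_1:A_1,\dots,\alpha_n:A_n\vdash\gamma:C$ which corresponds to $P$ (with the same identification). -/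

import Mathlib

namespace Displacement

/-! ### String terms -/

/-- The items of a string term over an alphabet `W`: variables and the separator `1`. -/
inductive Tok (W : Type*) where
  | sep : Tok W
  | var (w : W) : Tok W

/-- String terms: sequences of variables and separators, with concatenation `++` and empty
string `[]`. -/
abbrev Str (W : Type*) := List (Tok W)

/-- Renaming of the variables of a string term. -/
def Tok.map {W W' : Type*} (g : W → W') : Tok W → Tok W'
  | .sep => .sep
  | .var w => .var (g w)

/-- The sort of an item, given the sorts of the variables; the separator has sort `1`. -/
def Tok.sort {W : Type*} (s : W → ℕ) : Tok W → ℕ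
  | .sep => 1
  | .var w => s w

/-- The sort of a string is the sum of the sorts of its items. -/
def Str.sort {W : Type*} (s : W → ℕ) (α : Str W) : ℕ := (α.map (Tok.sort s)).sum

/-- The string `w₀ + 1 + w₁ + ⋯ + 1 + wₙ`. -/
def separated {W : Type*} (ws : List W) : Str W := (ws.map Tok.var).intersperse Tok.sep

/-- The index `k` of a wrap operation: `>` (leftmost separator), `<` (rightmost separator),
or the number `n ≥ 1` of a separator, counted from the left. -/
inductive Pos where
  | first : Pos
  | last : Pos
  | nth (n : ℕ) : Pos
  deriving DecidableEq

/-- The separator `k` exists in a string of sort `n`. -/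
def Pos.Valid : Pos → ℕ → Prop
  | .first, n => 1 ≤ n
  | .last, n => 1 ≤ n
  | .nth j, n => 1 ≤ j ∧ j ≤ n

/-- In `α₁ + 1 + α₂`, with `n₁`, `n₂` the sorts of `α₁`, `α₂`, the displayed separator is the
one which is indicated by `k`. -/
def Pos.Splits : Pos → ℕ → ℕ → Prop
  | .first, n₁, _ => n₁ = 0
  | .last, _, n₂ => n₂ = 0
  | .nth j, n₁, _ => n₁ + 1 = j

/-- The modes of composition: concatenation `+` and the wraps `×ₖ`. -/
inductive Mode where
  | concat : Mode
  | wrap (k : Pos) : Mode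
  deriving DecidableEq

/-- `Comp s m α β ω`: the composition in mode `m` of `α` and `β` is defined and equals `ω`, that
is `ω = α + β`, respectively `ω = α ×ₖ β`. -/
def Comp {W : Type*} (s : W → ℕ) : Mode → Str W → Str W → Str W → Prop
  | .concat, α, β, ω => ω = α ++ β
  | .wrap k, α, β, ω => ∃ α₁ α₂ : Str W, α = α₁ ++ Tok.sep :: α₂ ∧
      k.Splits (Str.sort s α₁) (Str.sort s α₂) ∧ ω = α₁ ++ β ++ α₂

/-! ### Formulas and sorts -/

/-- Formulas over a set `At` of atoms. In mode `+` the three connectives are `C / B`, `A \ C` and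
`A • B`; in mode `×ₖ` they are `C ↑ₖ B`, `A ↓ₖ C` and `A ⊙ₖ B`. -/
inductive Formula (At : Type*) where
  | atom (a : At) : Formula At
  | over (m : Mode) (C B : Formula At) : Formula At
  | under (m : Mode) (A C : Formula At) : Formula At
  | prod (m : Mode) (A B : Formula At) : Formula At

section
variable {At : Type*} (σ : At → ℕ)

/-- The sort of a formula, given the sorts of the atoms. The subtractions do not truncate for
well-formed formulas. -/
def Formula.sort : Formula At → ℕ
  | .atom a => σ a
  | .over .concat C B => C.sort - B.sort
  | .over (.wrap _) C B => C.sort + 1 - B.sort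
  | .under .concat A C => C.sort - A.sort
  | .under (.wrap _) A C => C.sort + 1 - A.sort
  | .prod .concat A B => A.sort + B.sort
  | .prod (.wrap _) A B => A.sort + B.sort - 1

/-- The well-formed formulas: every subformula has a sort, and the separator to which a wrap
connective refers exists. -/
def Formula.WF : Formula At → Prop
  | .atom _ => True
  | .over .concat C B => C.WF ∧ B.WF ∧ B.sort σ ≤ C.sort σ
  | .over (.wrap k) C B => C.WF ∧ B.WF ∧ B.sort σ ≤ C.sort σ ∧
      k.Valid (C.sort σ + 1 - B.sort σ)
  | .under .concat A C => A.WF ∧ C.WF ∧ A.sort σ ≤ C.sort σ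
  | .under (.wrap k) A C => A.WF ∧ C.WF ∧ A.sort σ ≤ C.sort σ + 1 ∧ k.Valid (A.sort σ)
  | .prod .concat A B => A.WF ∧ B.WF
  | .prod (.wrap k) A B => A.WF ∧ B.WF ∧ k.Valid (A.sort σ)

/-! ### Natural deduction -/

/-- The alphabet of string terms. The sorted string variable number `x` of sort `n` abbreviates
`p₀ + 1 + ⋯ + 1 + pₙ`, where `pᵢ` is the letter `(x, i)`. -/
abbrev Letter := ℕ × ℕ

/-- All letters are of sort `0`. -/
def letterSort : Letter → ℕ := fun _ => 0

/-- The string of a hypothesis `x : A`. -/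
def hypString (x : ℕ) (A : Formula At) : Str Letter :=
  separated ((List.range (A.sort σ + 1)).map fun i => (x, i))

/-- The names of the hypotheses of a context. -/
def names (Γ : Multiset (ℕ × Formula At)) : Multiset ℕ := Γ.map Prod.fst

/-- `ND σ Γ γ C` is the type of natural deduction proofs of `γ : C` from the (undischarged)
hypotheses `Γ`. Two subproofs may be combined only if their hypotheses have different
names, so that the names in a context are always pairwise distinct. -/
inductive ND : Multiset (ℕ × Formula At) → Str Letter → Formula At → Type _ where
  /-- hypothesis -/
  | ax (x : ℕ) (A : Formula At) (hA : A.WF σ) : ND {(x, A)} (hypString σ x A) A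
  /-- `/ E` and `↑ₖ E` -/
  | overE {Γ Δ : Multiset (ℕ × Formula At)} {γ β ω : Str Letter} {C B : Formula At} (m : Mode)
      (d₁ : ND Γ γ (.over m C B)) (d₂ : ND Δ β B) (hd : Disjoint (names Γ) (names Δ))
      (h : Comp letterSort m γ β ω) : ND (Γ + Δ) ω C
  /-- `/ I` and `↑ₖ I` -/
  | overI {Γ : Multiset (ℕ × Formula At)} {γ ω : Str Letter} {C B : Formula At} (m : Mode)
      (x : ℕ) (d : ND ((x, B) ::ₘ Γ) ω C)
      (h : Comp letterSort m γ (hypString σ x B) ω) : ND Γ γ (.over m C B)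
  /-- `\ E` and `↓ₖ E` -/
  | underE {Γ Δ : Multiset (ℕ × Formula At)} {α γ ω : Str Letter} {A C : Formula At} (m : Mode)
      (d₁ : ND Γ α A) (d₂ : ND Δ γ (.under m A C)) (hd : Disjoint (names Γ) (names Δ))
      (h : Comp letterSort m α γ ω) : ND (Γ + Δ) ω C
  /-- `\ I` and `↓ₖ I` -/
  | underI {Γ : Multiset (ℕ × Formula At)} {γ ω : Str Letter} {A C : Formula At} (m : Mode)
      (x : ℕ) (d : ND ((x, A) ::ₘ Γ) ω C)
      (h : Comp letterSort m (hypString σ x A) γ ω) : ND Γ γ (.under m A C)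
  /-- `• I` and `⊙ₖ I` -/
  | prodI {Γ Δ : Multiset (ℕ × Formula At)} {α β ω : Str Letter} {A B : Formula At} (m : Mode)
      (d₁ : ND Γ α A) (d₂ : ND Δ β B) (hd : Disjoint (names Γ) (names Δ))
      (h : Comp letterSort m α β ω) : ND (Γ + Δ) ω (.prod m A B)
  /-- `• E` and `⊙ₖ E` -/
  | prodE {Γ Δ : Multiset (ℕ × Formula At)} {δ γ₁ ζ γ₂ : Str Letter} {A B C : Formula At}
      (m : Mode) (x y : ℕ) (d₁ : ND Γ δ (.prod m A B))
      (d₂ : ND ((x, A) ::ₘ (y, B) ::ₘ Δ) (γ₁ ++ ζ ++ γ₂) C)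
      (hd : Disjoint (names Γ) (names Δ))
      (h : Comp letterSort m (hypString σ x A) (hypString σ y B) ζ) :
      ND (Γ + Δ) (γ₁ ++ δ ++ γ₂) C

end

/-! ### Proof structures -/

/-- The links over a set `V` of formula occurrences. The first three are the tensor links, the
last three the par links. -/
inductive Link (V : Type*) where
  /-- `[L /]`, `[L ↑ₖ]`: premisses `f : C / B` and `b : B`, conclusion `c : C` -/
  | overL (m : Mode) (f b c : V) : Link V
  /-- `[L \]`, `[L ↓ₖ]`: premisses `a : A` and `f : A \ C`, conclusion `c : C` -/
  | underL (m : Mode) (a f c : V) : Link V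
  /-- `[R •]`, `[R ⊙ₖ]`: premisses `a : A` and `b : B`, conclusion `p : A • B` -/
  | prodR (m : Mode) (a b p : V) : Link V
  /-- `[R /]`, `[R ↑ₖ]`: premiss `c : C`, conclusions `f : C / B` (main) and `b : B` -/
  | overR (m : Mode) (c f b : V) : Link V
  /-- `[R \]`, `[R ↓ₖ]`: premiss `c : C`, conclusions `a : A` and `f : A \ C` (main) -/
  | underR (m : Mode) (c a f : V) : Link V
  /-- `[L •]`, `[L ⊙ₖ]`: premiss `p : A • B` (main), conclusions `a : A` and `b : B` -/
  | prodL (m : Mode) (p a b : V) : Link V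
  deriving DecidableEq

namespace Link
variable {V : Type*}

def prems : Link V → List V
  | overL _ f b _ => [f, b]
  | underL _ a f _ => [a, f]
  | prodR _ a b _ => [a, b]
  | overR _ c _ _ => [c]
  | underR _ c _ _ => [c]
  | prodL _ p _ _ => [p]

def concls : Link V → List V
  | overL _ _ _ c => [c]
  | underL _ _ _ c => [c]
  | prodR _ _ _ p => [p]
  | overR _ _ f b => [f, b]
  | underR _ _ a f => [a, f]
  | prodL _ _ a b => [a, b]

/-- The active conclusions of a par link: all its conclusions but the main formula. -/
def active : Link V → List V
  | overL _ _ _ _ => []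
  | underL _ _ _ _ => []
  | prodR _ _ _ _ => []
  | overR _ _ _ b => [b]
  | underR _ _ a _ => [a]
  | prodL _ _ a b => [a, b]

/-- The formulas at the vertices of the link are as required by its type. -/
def Instance {At : Type*} (label : V → Formula At) : Link V → Prop
  | overL m f b c => label f = .over m (label c) (label b)
  | underL m a f c => label f = .under m (label a) (label c)
  | prodR m a b p => label p = .prod m (label a) (label b)
  | overR m c f b => label f = .over m (label c) (label b)
  | underR m c a f => label f = .under m (label a) (label c)
  | prodL m p a b => label p = .prod m (label a) (label b)

end Link

/-- Proof structures: a finite set `verts` of formula occurrences, the occurrence `v` being one of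
the formula `label v`, with a finite set of links. The values of `label` outside `verts` play no
role. -/
structure ProofStructure {At : Type*} (σ : At → ℕ) (V : Type*) where
  verts : Finset V
  label : V → Formula At
  links : Finset (Link V)
  wf : ∀ v ∈ verts, (label v).WF σ
  mem_verts : ∀ l ∈ links, ∀ v ∈ l.prems ++ l.concls, v ∈ verts
  isInstance : ∀ l ∈ links, l.Instance label
  /-- No occurrence is used twice as a premiss (of two links, or of one). -/
  prems_nodup : (links.val.bind fun l => (l.prems : Multiset V)).Nodup
  /-- No occurrence is used twice as a conclusion. -/
  concls_nodup : (links.val.bind fun l => (l.concls : Multiset V)).Nodup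

/-! ### Abstract proof structures and contractions -/

/-- The links of an abstract proof structure with set of vertices `W`. The active conclusions of
a par link form lists of vertices, since auxiliary inputs are split at their separators. -/
inductive ALink (W : Type*) where
  /-- a comb with list of premisses `ps` and conclusion `c` -/
  | comb (ps : Str W) (c : W) : ALink W
  /-- the tensor link `×ₖ` with premisses `l`, `r` and conclusion `c` -/
  | wrap (k : Pos) (l r c : W) : ALink W
  /-- par link `/` or `↑ₖ` -/
  | parOver (m : Mode) (prem main : W) (act : List W) : ALink W
  /-- par link `\` or `↓ₖ` -/
  | parUnder (m : Mode) (prem : W) (act : List W) (main : W) : ALink W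
  /-- par link `•` or `⊙ₖ` -/
  | parProd (m : Mode) (main : W) (actA actB : List W) : ALink W

/-- One contraction step, for given sorts `s` of the vertices; `R` is the set of the other
links. No premiss of a comb may be identical to its conclusion. -/
inductive Step {W : Type*} (s : W → ℕ) : Multiset (ALink W) → Multiset (ALink W) → Prop where
  /-- `[+]` -/
  | plus (R : Multiset (ALink W)) (α₁ α₂ β : Str W) (u v : W)
      (hv : Tok.var v ∉ α₁ ++ β ++ α₂) :
      Step s (.comb β u ::ₘ .comb (α₁ ++ Tok.var u :: α₂) v ::ₘ R)
        (.comb (α₁ ++ β ++ α₂) v ::ₘ R)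
  /-- `[×ₖ]` -/
  | times (R : Multiset (ALink W)) (k : Pos) (α β ω : Str W) (l r v : W)
      (h : Comp s (.wrap k) α β ω) (hv : Tok.var v ∉ ω) :
      Step s (.comb α l ::ₘ .comb β r ::ₘ .wrap k l r v ::ₘ R) (.comb ω v ::ₘ R)
  /-- `[\]` and `[↓ₖ]` -/
  | under (R : Multiset (ALink W)) (m : Mode) (β ω : Str W) (act : List W) (u v : W)
      (h : Comp s m (separated act) β ω) (hv : Tok.var v ∉ β) :
      Step s (.comb ω u ::ₘ .parUnder m u act v ::ₘ R) (.comb β v ::ₘ R)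
  /-- `[/]` and `[↑ₖ]` -/
  | over (R : Multiset (ALink W)) (m : Mode) (γ ω : Str W) (act : List W) (u v : W)
      (h : Comp s m γ (separated act) ω) (hv : Tok.var v ∉ γ) :
      Step s (.comb ω u ::ₘ .parOver m u v act ::ₘ R) (.comb γ v ::ₘ R)
  /-- `[•]` and `[⊙ₖ]` -/
  | prod (R : Multiset (ALink W)) (m : Mode) (γ₁ γ₂ ζ : Str W) (actA actB : List W) (v₁ v₂ : W)
      (h : Comp s m (separated actA) (separated actB) ζ)
      (hv : Tok.var v₂ ∉ γ₁ ++ Tok.var v₁ :: γ₂) :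
      Step s (.comb (γ₁ ++ ζ ++ γ₂) v₂ ::ₘ .parProd m v₁ actA actB ::ₘ R)
        (.comb (γ₁ ++ Tok.var v₁ :: γ₂) v₂ ::ₘ R)

/-- The vertices of the abstract proof structure of a proof structure over `V`: the formula
occurrences, and the vertices `p₀, p₁, …` which are added above each input. -/
inductive AVert (V : Type*) where
  | node (v : V) : AVert V
  | piece (v : V) (i : ℕ) : AVert V

namespace ProofStructure
variable {At : Type*} {σ : At → ℕ} {V : Type*} (P : ProofStructure σ V)

/-- The added vertices for an occurrence of a formula of sort `n` are `p₀, …, pₙ`. -/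
def pieces (v : V) : List (AVert V) :=
  (List.range ((P.label v).sort σ + 1)).map (AVert.piece v)

/-- The sorts of the vertices of the abstract proof structure. -/
def vertSort : AVert V → ℕ
  | .node v => (P.label v).sort σ
  | .piece _ _ => 0

/-- Tensor links `+` become combs with two premisses, tensor links `×ₖ` remain. -/
def tensorLink : Mode → V → V → V → ALink (AVert V)
  | .concat, l, r, c => .comb [.var (.node l), .var (.node r)] (.node c)
  | .wrap k, l, r, c => .wrap k (.node l) (.node r) (.node c)

/-- The abstract version of a link. -/
def absLink : Link V → ALink (AVert V)
  | .overL m f b c => tensorLink m f b c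
  | .underL m a f c => tensorLink m a f c
  | .prodR m a b p => tensorLink m a b p
  | .overR m c f b => .parOver m (.node c) (.node f) (P.pieces b)
  | .underR m c a f => .parUnder m (.node c) (P.pieces a) (.node f)
  | .prodL m p a b => .parProd m (.node p) (P.pieces a) (P.pieces b)

variable [DecidableEq V]

/-- The hypotheses of a proof structure. -/
def hyps : Finset V := P.verts.filter fun v => ∀ l ∈ P.links, v ∉ l.concls

/-- The conclusions of a proof structure. -/
def conclusions : Finset V := P.verts.filter fun v => ∀ l ∈ P.links, v ∉ l.prems

/-- The inputs of a proof structure: its hypotheses and the active conclusions of par links. -/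
def inputs : Finset V := P.hyps ∪ P.verts.filter fun v => ∃ l ∈ P.links, v ∈ l.active

/-- The abstract proof structure of a proof structure: the translations of its links, and a comb
with premisses `p₀, 1, p₁, …, 1, pₙ` for each input of sort `n`. -/
def abstract : Multiset (ALink (AVert V)) :=
  P.links.val.map P.absLink +
    P.inputs.val.map fun v => .comb (separated (P.pieces v)) (.node v)

/-- The abstract proof structure of `P` contracts to the single comb with premisses `ω` and
conclusion `c`. -/
def ContractsTo (ω : Str (AVert V)) (c : AVert V) : Prop :=
  Relation.ReflTransGen (Step P.vertSort) P.abstract {.comb ω c} ∧ Tok.var c ∉ ω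

/-- The abstract proof structure of `P` contracts to a single comb. -/
def ContractsToComb : Prop := ∃ ω c, P.ContractsTo ω c

end ProofStructure

/-! ### Proof nets -/

section
variable {At : Type*} {σ : At → ℕ} {V : Type*} [DecidableEq V]

/-- `d.Corresponds label vs ls f c`: the natural deduction proof `d` corresponds to the proof
structure with occurrences `vs`, labelled by `label`, and links `ls`, where the hypothesis
of `d` with name `x` is the occurrence `f x`, and the end formula of `d` is the occurrence `c`.
A hypothesis corresponds to a single occurrence without links; each other rule adds its link to
the (disjoint) proof structures of its subproofs, together with a new occurrence of the
conclusion of the rule, except that `• E` and `⊙ₖ E` need no new occurrence. -/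
def ND.Corresponds (label : V → Formula At) :
    {Γ : Multiset (ℕ × Formula At)} → {γ : Str Letter} → {C : Formula At} → ND σ Γ γ C →
    Finset V → Finset (Link V) → (ℕ → V) → V → Prop
  | _, _, _, .ax x A _, vs, ls, f, c => vs = {c} ∧ ls = ∅ ∧ f x = c ∧ label c = A
  | _, _, C, .overE m d₁ d₂ _ _, vs, ls, f, c => ∃ vs₁ vs₂ ls₁ ls₂ c₁ c₂,
      d₁.Corresponds label vs₁ ls₁ f c₁ ∧ d₂.Corresponds label vs₂ ls₂ f c₂ ∧
      Disjoint vs₁ vs₂ ∧ c ∉ vs₁ ∪ vs₂ ∧ label c = C ∧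
      vs = insert c (vs₁ ∪ vs₂) ∧ ls = insert (.overL m c₁ c₂ c) (ls₁ ∪ ls₂)
  | _, _, C, .underE m d₁ d₂ _ _, vs, ls, f, c => ∃ vs₁ vs₂ ls₁ ls₂ c₁ c₂,
      d₁.Corresponds label vs₁ ls₁ f c₁ ∧ d₂.Corresponds label vs₂ ls₂ f c₂ ∧
      Disjoint vs₁ vs₂ ∧ c ∉ vs₁ ∪ vs₂ ∧ label c = C ∧
      vs = insert c (vs₁ ∪ vs₂) ∧ ls = insert (.underL m c₁ c₂ c) (ls₁ ∪ ls₂)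
  | _, _, _, .prodI (A := A) (B := B) m d₁ d₂ _ _, vs, ls, f, c => ∃ vs₁ vs₂ ls₁ ls₂ c₁ c₂,
      d₁.Corresponds label vs₁ ls₁ f c₁ ∧ d₂.Corresponds label vs₂ ls₂ f c₂ ∧
      Disjoint vs₁ vs₂ ∧ c ∉ vs₁ ∪ vs₂ ∧ label c = .prod m A B ∧
      vs = insert c (vs₁ ∪ vs₂) ∧ ls = insert (.prodR m c₁ c₂ c) (ls₁ ∪ ls₂)
  | _, _, _, .overI (C := C) (B := B) m x d _, vs, ls, f, c => ∃ vs' ls' c' b,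
      d.Corresponds label vs' ls' (Function.update f x b) c' ∧ c ∉ vs' ∧
      label c = .over m C B ∧
      vs = insert c vs' ∧ ls = insert (.overR m c' c b) ls'
  | _, _, _, .underI (A := A) (C := C) m x d _, vs, ls, f, c => ∃ vs' ls' c' a,
      d.Corresponds label vs' ls' (Function.update f x a) c' ∧ c ∉ vs' ∧
      label c = .under m A C ∧
      vs = insert c vs' ∧ ls = insert (.underR m c' a c) ls'
  | _, _, _, .prodE m x y d₁ d₂ _ _, vs, ls, f, c => ∃ vs₁ vs₂ ls₁ ls₂ c₁ a b,
      d₁.Corresponds label vs₁ ls₁ f c₁ ∧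
      d₂.Corresponds label vs₂ ls₂ (Function.update (Function.update f x a) y b) c ∧
      Disjoint vs₁ vs₂ ∧ vs = vs₁ ∪ vs₂ ∧ ls = insert (.prodL m c₁ a b) (ls₁ ∪ ls₂)

/-- A proof structure is a proof net if it corresponds to a natural deduction proof. -/
def ProofStructure.IsProofNet (P : ProofStructure σ V) : Prop :=
  ∃ (Γ : Multiset (ℕ × Formula At)) (γ : Str Letter) (C : Formula At) (d : ND σ Γ γ C)
    (f : ℕ → V) (c : V), d.Corresponds P.label P.verts P.links f c

/-- The hypotheses of `P` are the hypotheses in `Γ`, the one with name `x` being `f x`. -/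
def ProofStructure.HasHyps (P : ProofStructure σ V) (Γ : Multiset (ℕ × Formula At))
    (f : ℕ → V) : Prop :=
  Γ.map (fun h => (f h.1, h.2)) = P.hyps.val.map fun v => (v, P.label v)

/-- The string `γ`, read as a list of vertices: the letter number `i` of the variable `x` is the
vertex `pᵢ` of the hypothesis `f x`. -/
def vertString (f : ℕ → V) (γ : Str Letter) : Str (AVert V) :=
  γ.map (Tok.map fun p => AVert.piece (f p.1) p.2)

end

end Displacement

open Displacement

/-!
The idea is to read natural deduction proofs as derivations (`Deriv`) in which the hypotheses are
named by the occurrences of the proof structure itself. A derivation records the multiset of its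
hypotheses and the multiset `L` of its links, and nothing forces the occurrences in its parts to
be different. This freedom is harmless because of `Deriv.balance`: its hypotheses together with
the conclusions of `L` are its conclusion `c` together with the premisses of `L`. Hence all
occurrences are pairwise different as soon as `c ::ₘ Link.premsOf L` has no duplicates, and for
the links of a proof structure this holds if `c` is not a premiss.

Soundness. A proof that corresponds to a proof structure is such a derivation
(`ND.Corresponds.represents`), and by induction on the derivation the combs of its inputs and its
links contract to one comb, whose premisses are the string of the derivation (`Deriv.contracts`).

Completeness. During a contraction sequence every comb carries a derivation of its conclusion from
its premisses, where a premiss that is an occurrence is read as a hypothesis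
(`ProofStructure.AllJustified.step`). The contraction `[+]` substitutes one derivation into
another, the other contractions are rules. In the end there is one derivation which uses every
link of the proof structure once. Every contraction removes the same vertices from the premisses
and from the conclusions (`Step.balance`), from which it follows that the occurrences are exactly
the conclusion of the last comb and the premisses of the links. So the occurrences of the
derivation are pairwise different. This makes it possible to eliminate the substitutions without
renaming (`Deriv.subst_elim`), by replacing the letters of a hypothesis in all strings by the
sort `0` parts of the substituted string, and then to choose names for the hypotheses
(`Deriv.exists_nd`).

That every natural deduction proof corresponds to some proof structure on `ℕ` is shown with a
labelling of `ℕ` in which each formula that is needed occurs infinitely often, so that fresh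
occurrences are always available (`ND.exists_realizable`).
-/

namespace Displacement

/-! ### Substitution, renaming and composition of strings -/

section Strings
variable {W W' : Type*}

/-- Simultaneous substitution of strings for the variables of a string. -/
def Str.subst (g : W → Str W') : Str W → Str W'
  | [] => []
  | .sep :: α => .sep :: Str.subst g α
  | .var w :: α => g w ++ Str.subst g α

/-- Renaming of the variables of a string. -/
def Str.rename (g : W → W') (α : Str W) : Str W' := α.map (Tok.map g)

/-- The multiset of the occurrences of variables in a string. -/
def Str.vars : Str W → Multiset W
  | [] => 0
  | .sep :: α => Str.vars α
  | .var w :: α => w ::ₘ Str.vars α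

@[simp] lemma Str.subst_append (g : W → Str W') (α β : Str W) :
    Str.subst g (α ++ β) = Str.subst g α ++ Str.subst g β := by
  induction α with
  | nil => rfl
  | cons t α ih => cases t <;> simp [Str.subst, ih]

@[simp] lemma Str.vars_append (α β : Str W) :
    Str.vars (α ++ β) = Str.vars α + Str.vars β := by
  induction α with
  | nil => simp [Str.vars]
  | cons t α ih => cases t <;> simp [Str.vars, ih]

@[simp] lemma Str.mem_vars {α : Str W} {w : W} : w ∈ Str.vars α ↔ Tok.var w ∈ α := by
  induction α with
  | nil => simp [Str.vars]
  | cons t α ih => cases t <;> simp [Str.vars, ih]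

@[simp] lemma Str.sort_nil (s : W → ℕ) : Str.sort s [] = 0 := rfl

@[simp] lemma Str.sort_cons (s : W → ℕ) (t : Tok W) (α : Str W) :
    Str.sort s (t :: α) = t.sort s + Str.sort s α := by
  simp [Str.sort]

@[simp] lemma Str.sort_append (s : W → ℕ) (α β : Str W) :
    Str.sort s (α ++ β) = Str.sort s α + Str.sort s β := by
  simp [Str.sort]

lemma Str.sort_subst {s : W → ℕ} {s' : W' → ℕ} {g : W → Str W'}
    (hg : ∀ w, Str.sort s' (g w) = s w) (α : Str W) :
    Str.sort s' (Str.subst g α) = Str.sort s α := by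
  induction α with
  | nil => rfl
  | cons t α ih => cases t <;> simp [Str.subst, Tok.sort, ih, hg]

lemma Str.subst_congr {g g' : W → Str W'} {α : Str W} (h : ∀ w, Tok.var w ∈ α → g w = g' w) :
    Str.subst g α = Str.subst g' α := by
  induction α with
  | nil => rfl
  | cons t α ih =>
    cases t with
    | sep => simp [Str.subst, ih fun w hw => h w (by simp [hw])]
    | var w => simp [Str.subst, ih fun w hw => h w (by simp [hw]), h w (by simp)]

lemma Str.rename_eq_subst (g : W → W') (α : Str W) :
    Str.rename g α = Str.subst (fun w => [Tok.var (g w)]) α := by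
  induction α with
  | nil => rfl
  | cons t α ih => cases t <;> simp_all [Str.subst, Str.rename, Tok.map]

lemma Str.subst_eq_self {g : W → Str W} {α : Str W}
    (h : ∀ w, Tok.var w ∈ α → g w = [Tok.var w]) : Str.subst g α = α := by
  rw [Str.subst_congr h]
  induction α with
  | nil => rfl
  | cons t α ih =>
    cases t <;> simp [Str.subst, ih fun w hw => h w (by simp [hw])]

@[simp] lemma Str.rename_append (g : W → W') (α β : Str W) :
    Str.rename g (α ++ β) = Str.rename g α ++ Str.rename g β := by
  simp [Str.rename]

lemma Str.rename_congr {g g' : W → W'} {α : Str W} (h : ∀ w, Tok.var w ∈ α → g w = g' w) :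
    Str.rename g α = Str.rename g' α := by
  simp only [Str.rename_eq_subst]
  exact Str.subst_congr fun w hw => by rw [h w hw]

lemma Str.rename_rename {W'' : Type*} (g : W → W') (g' : W' → W'') (α : Str W) :
    Str.rename g' (Str.rename g α) = Str.rename (fun w => g' (g w)) α := by
  simp only [Str.rename, List.map_map]
  congr 1
  funext t
  cases t <;> rfl

lemma Str.rename_eq_self {g : W → W} {α : Str W} (h : ∀ w, Tok.var w ∈ α → g w = w) :
    Str.rename g α = α := by
  rw [Str.rename_eq_subst]
  exact Str.subst_eq_self fun w hw => by rw [h w hw]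

lemma Str.mem_rename {g : W → W'} {α : Str W} {w' : W'} :
    Tok.var w' ∈ Str.rename g α ↔ ∃ w, Tok.var w ∈ α ∧ g w = w' := by
  simp only [Str.rename, List.mem_map]
  constructor
  · rintro ⟨t, ht, h⟩
    cases t with
    | sep => cases h
    | var w => exact ⟨w, ht, Tok.var.inj h⟩
  · rintro ⟨w, hw, rfl⟩
    exact ⟨_, hw, rfl⟩

/-! ### Separated strings -/

@[simp] lemma separated_cons_cons (w w' : W) (ws : List W) :
    separated (w :: w' :: ws) = Tok.var w :: Tok.sep :: separated (w' :: ws) := rfl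

@[simp] lemma separated_singleton (w : W) : separated [w] = [Tok.var w] := rfl

@[simp] lemma Str.vars_separated (ws : List W) : Str.vars (separated ws) = ws := by
  induction ws with
  | nil => rfl
  | cons w ws ih =>
    cases ws with
    | nil => rfl
    | cons w' ws =>
      rw [separated_cons_cons, Str.vars, Str.vars, ih]
      rfl

lemma rename_separated (g : W → W') (ws : List W) :
    Str.rename g (separated ws) = separated (ws.map g) := by
  induction ws with
  | nil => rfl
  | cons w ws ih =>
    cases ws with
    | nil => rfl
    | cons w' ws => simpa [Str.rename, Tok.map] using ih

lemma sort_separated_cons (s : W → ℕ) (w : W) (ws : List W) (h : ∀ x ∈ w :: ws, s x = 0) :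
    Str.sort s (separated (w :: ws)) = ws.length := by
  induction ws generalizing w with
  | nil => simpa [Tok.sort] using h
  | cons w' ws ih =>
    have := ih w' fun x hx => h x (List.mem_cons_of_mem _ hx)
    simp [Tok.sort, this, h w, add_comm]

lemma separated_cons (w : W) (ws : List W) :
    ∃ τ : Str W, separated (w :: ws) = Tok.var w :: τ ∧ Str.vars τ = ws := by
  cases ws with
  | nil => exact ⟨[], rfl, rfl⟩
  | cons w' ws => exact ⟨_, rfl, Str.vars_separated (w' :: ws)⟩

/-- A string `β₀ + 1 + ⋯ + 1 + βₙ` is the result of substituting `β₀, …, βₙ` for the variables of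
`w₀ + 1 + ⋯ + 1 + wₙ`. -/
lemma exists_subst_separated (β : Str W) (ws : List W) (hws : ws.Nodup)
    (hn : ws.length = Str.sort 0 β + 1) :
    ∃ g : W → Str W, (∀ w, Str.sort 0 (g w) = 0) ∧ (∀ w, w ∉ ws → g w = [Tok.var w]) ∧
      Str.subst g (separated ws) = β := by
  classical
  induction β generalizing ws with
  | nil =>
    obtain ⟨w, rfl⟩ := List.length_eq_one_iff.1 hn
    refine ⟨Function.update (fun w => [Tok.var w]) w [], fun x => ?_, fun x hx => ?_, ?_⟩
    · by_cases h : x = w <;> simp [h, Tok.sort]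
    · simp at hx
      simp [hx]
    · simp [Str.subst]
  | cons t β ih =>
    cases t with
    | sep =>
      match ws, hws, hn with
      | w :: w' :: ws, hws, hn =>
        simp only [List.length_cons, Str.sort_cons, Tok.sort] at hn
        obtain ⟨g, h₁, h₂, h₃⟩ := ih (w' :: ws) hws.of_cons (by simp; omega)
        refine ⟨Function.update g w [], fun x => ?_, fun x hx => ?_, ?_⟩
        · by_cases h : x = w <;> simp [h, h₁]
        · rw [List.mem_cons, not_or] at hx
          simp [hx.1, h₂ x hx.2]
        · have : Str.subst (Function.update g w []) (separated (w' :: ws))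
              = Str.subst g (separated (w' :: ws)) := by
            refine Str.subst_congr fun x hx => ?_
            rw [← Str.mem_vars, Str.vars_separated, Multiset.mem_coe] at hx
            have : x ≠ w := fun h => (List.nodup_cons.1 hws).1 (h ▸ hx)
            simp [this]
          simp [Str.subst, this, h₃]
      | [w], _, hn => simp [Tok.sort] at hn
      | [], _, hn => simp at hn
    | var y =>
      match ws, hws, hn with
      | w :: ws, hws, hn =>
        obtain ⟨g, h₁, h₂, h₃⟩ := ih (w :: ws) hws (by simpa [Tok.sort] using hn)
        obtain ⟨τ, hτ, hτ'⟩ := separated_cons w ws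
        refine ⟨Function.update g w (Tok.var y :: g w), fun x => ?_, fun x hx => ?_, ?_⟩
        · by_cases h : x = w <;> simp [h, h₁, Tok.sort]
        · have hx' := hx
          rw [List.mem_cons, not_or] at hx
          simp [hx.1, h₂ x hx']
        · have : Str.subst (Function.update g w (Tok.var y :: g w)) τ = Str.subst g τ := by
            refine Str.subst_congr fun x hx => ?_
            rw [← Str.mem_vars, hτ', Multiset.mem_coe] at hx
            have : x ≠ w := fun h => (List.nodup_cons.1 hws).1 (h ▸ hx)
            simp [this]
          rw [hτ] at h₃ ⊢
          simpa [Str.subst, this] using h₃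
      | [], _, hn => simp at hn

/-! ### Composition -/

lemma Comp.subst {s : W → ℕ} {s' : W' → ℕ} {g : W → Str W'}
    (hg : ∀ w, Str.sort s' (g w) = s w) {m : Mode} {α β ω : Str W} (h : Comp s m α β ω) :
    Comp s' m (Str.subst g α) (Str.subst g β) (Str.subst g ω) := by
  cases m with
  | concat =>
    cases h
    exact Str.subst_append g α β
  | wrap k =>
    obtain ⟨α₁, α₂, rfl, hk, rfl⟩ := h
    refine ⟨Str.subst g α₁, Str.subst g α₂, by simp [Str.subst], ?_, by simp⟩
    rwa [Str.sort_subst hg, Str.sort_subst hg]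

lemma Comp.rename {s : W → ℕ} {s' : W' → ℕ} {g : W → W'} (hg : ∀ w, s' (g w) = s w)
    {m : Mode} {α β ω : Str W} (h : Comp s m α β ω) :
    Comp s' m (Str.rename g α) (Str.rename g β) (Str.rename g ω) := by
  simp only [Str.rename_eq_subst]
  exact h.subst fun w => by simp [Tok.sort, hg]

lemma Comp.vars {s : W → ℕ} {m : Mode} {α β ω : Str W} (h : Comp s m α β ω) :
    Str.vars ω = Str.vars α + Str.vars β := by
  cases m with
  | concat => cases h; simp
  | wrap k =>
    obtain ⟨α₁, α₂, rfl, -, rfl⟩ := h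
    simp only [Str.vars_append, Str.vars]
    abel

lemma Comp.sort_concat {s : W → ℕ} {α β ω : Str W} (h : Comp s .concat α β ω) :
    Str.sort s ω = Str.sort s α + Str.sort s β := by
  cases h
  simp

lemma Comp.sort_wrap {s : W → ℕ} {k : Pos} {α β ω : Str W} (h : Comp s (.wrap k) α β ω) :
    Str.sort s ω + 1 = Str.sort s α + Str.sort s β ∧ k.Valid (Str.sort s α) := by
  obtain ⟨α₁, α₂, rfl, hk, rfl⟩ := h
  simp only [Str.sort_append, Str.sort_cons, Tok.sort]
  refine ⟨by omega, ?_⟩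
  cases k <;> simp only [Pos.Valid, Pos.Splits] at hk ⊢ <;> omega

end Strings

/-! ### Derivations named by occurrences -/

namespace Link
variable {V : Type*}

/-- `l.IsTensor m x y z`: `l` is a tensor link for the mode `m` with premisses `x`, `y` and
conclusion `z`. -/
inductive IsTensor : Link V → Mode → V → V → V → Prop
  | overL (m : Mode) (f b c : V) : IsTensor (.overL m f b c) m f b c
  | underL (m : Mode) (a f c : V) : IsTensor (.underL m a f c) m a f c
  | prodR (m : Mode) (a b p : V) : IsTensor (.prodR m a b p) m a b p

lemma IsTensor.prems {l : Link V} {m : Mode} {x y z : V} (h : l.IsTensor m x y z) :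
    (l.prems : Multiset V) = {x, y} := by
  cases h <;> rfl

lemma IsTensor.concls {l : Link V} {m : Mode} {x y z : V} (h : l.IsTensor m x y z) :
    (l.concls : Multiset V) = {z} := by
  cases h <;> rfl

lemma IsTensor.active {l : Link V} {m : Mode} {x y z : V} (h : l.IsTensor m x y z) :
    (l.active : Multiset V) = 0 := by
  cases h <;> rfl

/-- The premisses of the links in `L`. -/
def premsOf (L : Multiset (Link V)) : Multiset V := L.bind fun l => (l.prems : Multiset V)

/-- The conclusions of the links in `L`. -/
def conclsOf (L : Multiset (Link V)) : Multiset V := L.bind fun l => (l.concls : Multiset V)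

/-- The active conclusions of the links in `L`. -/
def activeOf (L : Multiset (Link V)) : Multiset V := L.bind fun l => (l.active : Multiset V)

@[simp] lemma premsOf_zero : premsOf (0 : Multiset (Link V)) = 0 := rfl
@[simp] lemma premsOf_cons (l : Link V) (L : Multiset (Link V)) :
    premsOf (l ::ₘ L) = l.prems + premsOf L := Multiset.cons_bind ..
@[simp] lemma conclsOf_cons (l : Link V) (L : Multiset (Link V)) :
    conclsOf (l ::ₘ L) = l.concls + conclsOf L := Multiset.cons_bind ..
@[simp] lemma activeOf_cons (l : Link V) (L : Multiset (Link V)) :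
    activeOf (l ::ₘ L) = l.active + activeOf L := Multiset.cons_bind ..

@[simp] lemma premsOf_add (L M : Multiset (Link V)) :
    premsOf (L + M) = premsOf L + premsOf M := Multiset.add_bind ..
@[simp] lemma conclsOf_add (L M : Multiset (Link V)) :
    conclsOf (L + M) = conclsOf L + conclsOf M := Multiset.add_bind ..
@[simp] lemma activeOf_add (L M : Multiset (Link V)) :
    activeOf (L + M) = activeOf L + activeOf M := Multiset.add_bind ..

lemma active_subset (l : Link V) : l.active ⊆ l.concls := by
  cases l <;> simp [active, concls]

lemma activeOf_le (L : Multiset (Link V)) :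
    activeOf L ≤ conclsOf L := by
  induction L using Multiset.induction with
  | empty => exact le_rfl
  | cons l L ih =>
    rw [activeOf_cons, conclsOf_cons]
    refine add_le_add (Multiset.coe_le.2 (List.Sublist.subperm ?_)) ih
    cases l <;> simp [active, concls]

end Link

section
variable {At V : Type*} (σ : At → ℕ) (label : V → Formula At)

/-- The letters of the occurrence `v`, seen as a hypothesis of sort `n`: `(v, 0), …, (v, n)`. -/
def occLetters (v : V) : List (V × ℕ) :=
  (List.range ((label v).sort σ + 1)).map fun i => (v, i)

/-- The string of the occurrence `v`, seen as a hypothesis. -/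
def occString (v : V) : Str (V × ℕ) := separated (occLetters σ label v)

/-- `AbsRule σ label l c' c b γ ω`: the par link `l`, with premiss `c'`, main conclusion `c` and
active conclusion `b`, takes a proof of `ω : c'` to a proof of `γ : c` in which the hypothesis `b`
is withdrawn. -/
inductive AbsRule : Link V → V → V → V → Str (V × ℕ) → Str (V × ℕ) → Prop
  | overR {m : Mode} {c' c b : V} {γ ω : Str (V × ℕ)}
      (h : Comp 0 m γ (occString σ label b) ω) :
      AbsRule (.overR m c' c b) c' c b γ ω
  | underR {m : Mode} {c' c b : V} {γ ω : Str (V × ℕ)}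
      (h : Comp 0 m (occString σ label b) γ ω) :
      AbsRule (.underR m c' b c) c' c b γ ω

/-- `Deriv σ label cut H ω c L`: from the hypotheses `H` there is a proof of `ω : c` whose links
are `L`. Hypotheses are named by occurrences, the letters of `v` being `(v, 0), (v, 1), …`.
Nothing ensures that the occurrences in different subproofs are different: this is recovered from
`L` by `Deriv.balance`. The substitution of a proof for a hypothesis is a rule if `cut` holds. -/
inductive Deriv (cut : Prop) :
    Multiset V → Str (V × ℕ) → V → Multiset (Link V) → Prop
  /-- hypothesis -/
  | ax (v : V) (hv : (label v).WF σ) : Deriv cut {v} (occString σ label v) v 0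
  /-- elimination of `/`, `\`, `↑ₖ`, `↓ₖ` and introduction of `•`, `⊙ₖ` -/
  | tensor {H₁ H₂ : Multiset V} {α β ω : Str (V × ℕ)} {x y z : V} {L₁ L₂ : Multiset (Link V)}
      {l : Link V} {m : Mode} (hl : l.IsTensor m x y z) (hi : l.Instance label)
      (d₁ : Deriv cut H₁ α x L₁) (d₂ : Deriv cut H₂ β y L₂) (h : Comp 0 m α β ω) :
      Deriv cut (H₁ + H₂) ω z (l ::ₘ (L₁ + L₂))
  /-- introduction of `/`, `\`, `↑ₖ`, `↓ₖ` -/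
  | abs {H : Multiset V} {γ ω : Str (V × ℕ)} {c' c b : V} {L : Multiset (Link V)} {l : Link V}
      (hl : AbsRule σ label l c' c b γ ω) (hi : l.Instance label)
      (d : Deriv cut (b ::ₘ H) ω c' L) : Deriv cut H γ c (l ::ₘ L)
  /-- elimination of `•`, `⊙ₖ` -/
  | prodE {H₁ H₂ : Multiset V} {δ γ₁ ζ γ₂ : Str (V × ℕ)} {p a b c : V}
      {L₁ L₂ : Multiset (Link V)} {m : Mode} (hi : (Link.prodL m p a b).Instance label)
      (d₁ : Deriv cut H₁ δ p L₁) (d₂ : Deriv cut (a ::ₘ b ::ₘ H₂) (γ₁ ++ ζ ++ γ₂) c L₂)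
      (h : Comp 0 m (occString σ label a) (occString σ label b) ζ) :
      Deriv cut (H₁ + H₂) (γ₁ ++ δ ++ γ₂) c (.prodL m p a b ::ₘ (L₁ + L₂))
  /-- substitution of a proof of `u` for the hypothesis `u` -/
  | subst {H₁ H₂ : Multiset V} {β γ₁ γ₂ : Str (V × ℕ)} {u c : V} {L₁ L₂ : Multiset (Link V)}
      (hc : cut) (d₁ : Deriv cut H₁ β u L₁)
      (d₂ : Deriv cut (u ::ₘ H₂) (γ₁ ++ occString σ label u ++ γ₂) c L₂) :
      Deriv cut (H₁ + H₂) (γ₁ ++ β ++ γ₂) c (L₁ + L₂)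

variable {σ label}

lemma nodup_occLetters (v : V) : (occLetters σ label v).Nodup :=
  List.nodup_range.map fun _ _ h => (Prod.mk.inj h).2

lemma mem_occLetters {v : V} {p : V × ℕ} (h : p ∈ occLetters σ label v) : p.1 = v := by
  obtain ⟨i, -, rfl⟩ := List.mem_map.1 h
  rfl

lemma zero_mem_occLetters (v : V) : (v, 0) ∈ occLetters σ label v :=
  List.mem_map.2 ⟨0, by simp, rfl⟩

lemma vars_occString (v : V) :
    Str.vars (occString σ label v) = (occLetters σ label v : Multiset (V × ℕ)) :=
  Str.vars_separated _

lemma sort_occString (v : V) : Str.sort 0 (occString σ label v) = (label v).sort σ := by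
  rw [occString, occLetters, List.range_succ_eq_map, List.map_cons,
    sort_separated_cons 0 _ _ fun _ _ => rfl]
  simp

lemma AbsRule.prems {l : Link V} {c' c b : V} {γ ω : Str (V × ℕ)}
    (h : AbsRule σ label l c' c b γ ω) : (l.prems : Multiset V) = {c'} := by
  cases h <;> rfl

lemma AbsRule.active {l : Link V} {c' c b : V} {γ ω : Str (V × ℕ)}
    (h : AbsRule σ label l c' c b γ ω) : (l.active : Multiset V) = {b} := by
  cases h <;> rfl

lemma AbsRule.concls {l : Link V} {c' c b : V} {γ ω : Str (V × ℕ)}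
    (h : AbsRule σ label l c' c b γ ω) : (l.concls : Multiset V) = {c, b} := by
  cases h
  · rfl
  · exact Multiset.pair_comm _ _

lemma AbsRule.vars {l : Link V} {c' c b : V} {γ ω : Str (V × ℕ)}
    (h : AbsRule σ label l c' c b γ ω) :
    Str.vars ω = occLetters σ label b + Str.vars γ := by
  cases h with
  | overR h => rw [h.vars, vars_occString, add_comm]
  | underR h => rw [h.vars, vars_occString]

/-- The letters of the hypotheses in `H`. -/
def lettersOf (σ : At → ℕ) (label : V → Formula At) (H : Multiset V) : Multiset (V × ℕ) :=
  H.bind fun v => (occLetters σ label v : Multiset (V × ℕ))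

@[simp] lemma lettersOf_cons (v : V) (H : Multiset V) :
    lettersOf σ label (v ::ₘ H) = occLetters σ label v + lettersOf σ label H :=
  Multiset.cons_bind ..

@[simp] lemma lettersOf_add (H K : Multiset V) :
    lettersOf σ label (H + K) = lettersOf σ label H + lettersOf σ label K :=
  Multiset.add_bind ..

lemma mem_of_mem_lettersOf {H : Multiset V} {p : V × ℕ} (h : p ∈ lettersOf σ label H) :
    p.1 ∈ H := by
  obtain ⟨v, hv, hp⟩ := Multiset.mem_bind.1 h
  exact mem_occLetters (Multiset.mem_coe.1 hp) ▸ hv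

/-- Every hypothesis of sort `n` can be recovered from its letter number `0`. -/
lemma count_lettersOf [DecidableEq V] (H : Multiset V) (v : V) :
    (lettersOf σ label H).count (v, 0) = H.count v := by
  induction H using Multiset.induction with
  | empty => rfl
  | cons u H ih =>
    rw [lettersOf_cons, Multiset.count_add, ih, Multiset.count_cons, add_comm]
    congr 1
    split_ifs with h
    · subst h
      exact Multiset.count_eq_one_of_mem (Multiset.coe_nodup.2 (nodup_occLetters _))
        (Multiset.mem_coe.2 (zero_mem_occLetters _))
    · exact Multiset.count_eq_zero.2 fun h' => h (mem_occLetters (Multiset.mem_coe.1 h'))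

lemma le_of_lettersOf_le {H K : Multiset V} (h : lettersOf σ label H ≤ lettersOf σ label K) :
    H ≤ K := by
  classical
  refine Multiset.le_iff_count.2 fun v => ?_
  rw [← count_lettersOf (σ := σ) (label := label), ← count_lettersOf (σ := σ) (label := label)]
  exact Multiset.le_iff_count.1 h _

variable {cut : Prop} {H : Multiset V} {ω : Str (V × ℕ)} {c : V} {L : Multiset (Link V)}

/-- In the string of a derivation, every letter of the hypotheses occurs exactly once. -/
lemma Deriv.vars (d : Deriv σ label cut H ω c L) : Str.vars ω = lettersOf σ label H := by
  classical
  induction d with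
  | ax v hv => rw [vars_occString, lettersOf, Multiset.singleton_bind]
  | tensor hl hi d₁ d₂ h ih₁ ih₂ => rw [h.vars, ih₁, ih₂, lettersOf_add]
  | abs hl hi d ih =>
    rw [hl.vars, lettersOf_cons] at ih
    exact add_left_cancel ih
  | prodE hi d₁ d₂ h ih₁ ih₂ =>
    simp only [Str.vars_append, h.vars, vars_occString, lettersOf_cons, lettersOf_add] at ih₁ ih₂ ⊢
    ext p
    have := congrArg (Multiset.count p) ih₂
    simp only [Multiset.count_add, ih₁] at this ⊢
    omega
  | subst hc d₁ d₂ ih₁ ih₂ =>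
    simp only [Str.vars_append, vars_occString, lettersOf_cons, lettersOf_add] at ih₁ ih₂ ⊢
    ext p
    have := congrArg (Multiset.count p) ih₂
    simp only [Multiset.count_add, ih₁] at this ⊢
    omega

/-- The vertices of a proof structure are on the one hand its hypotheses and the conclusions of
its links, on the other hand its conclusion and the premisses of its links. -/
lemma Deriv.balance (d : Deriv σ label cut H ω c L) :
    H + Link.conclsOf L = c ::ₘ Link.premsOf L := by
  classical
  induction d with
  | ax v hv => rfl
  | tensor hl hi d₁ d₂ h ih₁ ih₂ =>
    simp only [Link.conclsOf_cons, Link.conclsOf_add, Link.premsOf_cons, Link.premsOf_add,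
      hl.prems, hl.concls, Multiset.insert_eq_cons]
    ext v
    have h₁ := congrArg (Multiset.count v) ih₁
    have h₂ := congrArg (Multiset.count v) ih₂
    simp only [← Multiset.singleton_add, Multiset.count_add] at h₁ h₂ ⊢
    omega
  | abs hl hi d ih =>
    simp only [Link.conclsOf_cons, Link.premsOf_cons, hl.prems, hl.concls,
      Multiset.insert_eq_cons]
    ext v
    have h₁ := congrArg (Multiset.count v) ih
    simp only [← Multiset.singleton_add, Multiset.count_add] at h₁ ⊢
    omega
  | prodE hi d₁ d₂ h ih₁ ih₂ =>
    simp only [Link.conclsOf_cons, Link.conclsOf_add, Link.premsOf_cons, Link.premsOf_add,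
      Link.prems, Link.concls, ← Multiset.cons_coe, Multiset.coe_nil]
    ext v
    have h₁ := congrArg (Multiset.count v) ih₁
    have h₂ := congrArg (Multiset.count v) ih₂
    simp only [← Multiset.singleton_add, Multiset.count_add, Multiset.count_zero] at h₁ h₂ ⊢
    omega
  | subst hc d₁ d₂ ih₁ ih₂ =>
    simp only [Link.conclsOf_add, Link.premsOf_add]
    ext v
    have h₁ := congrArg (Multiset.count v) ih₁
    have h₂ := congrArg (Multiset.count v) ih₂
    simp only [← Multiset.singleton_add, Multiset.count_add] at h₁ h₂ ⊢
    omega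

lemma Link.IsTensor.wf_sort {l : Link V} {m : Mode} {x y z : V} {α β ω : Str (V × ℕ)}
    (hl : l.IsTensor m x y z) (hi : l.Instance label) (h : Comp 0 m α β ω)
    (hx : (label x).WF σ) (hy : (label y).WF σ) (hα : Str.sort 0 α = (label x).sort σ)
    (hβ : Str.sort 0 β = (label y).sort σ) :
    (label z).WF σ ∧ Str.sort 0 ω = (label z).sort σ := by
  cases m with
  | concat =>
    have hs := h.sort_concat
    cases hl <;> simp only [Link.Instance] at hi <;>
      simp only [hi, Formula.WF, Formula.sort] at hx hy hα hβ ⊢ <;>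
      exact ⟨by tauto, by omega⟩
  | wrap k =>
    have hs := h.sort_wrap
    rw [hα] at hs
    cases hl <;> simp only [Link.Instance] at hi <;>
      simp only [hi, Formula.WF, Formula.sort] at hx hy hα hβ hs ⊢ <;>
      exact ⟨by tauto, by omega⟩

lemma AbsRule.wf_sort {l : Link V} {c' c b : V} {γ ω : Str (V × ℕ)}
    (hl : AbsRule σ label l c' c b γ ω) (hi : l.Instance label)
    (hb : (label b).WF σ) (hc' : (label c').WF σ) (hω : Str.sort 0 ω = (label c').sort σ) :
    (label c).WF σ ∧ Str.sort 0 γ = (label c).sort σ := by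
  cases hl with
  | @overR m _ _ _ _ _ h =>
    simp only [Link.Instance] at hi
    cases m with
    | concat =>
      have hs := h.sort_concat
      rw [sort_occString] at hs
      simp only [hi, Formula.WF, Formula.sort]
      exact ⟨⟨hc', hb, by omega⟩, by omega⟩
    | wrap k =>
      obtain ⟨hs, hk⟩ := h.sort_wrap
      rw [sort_occString] at hs
      have hγ : Str.sort 0 γ = (label c').sort σ + 1 - (label b).sort σ := by omega
      have : 1 ≤ Str.sort 0 γ := by
        cases k <;> simp only [Pos.Valid] at hk <;> omega
      simp only [hi, Formula.WF, Formula.sort]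
      exact ⟨⟨hc', hb, by omega, hγ ▸ hk⟩, hγ⟩
  | @underR m _ _ _ _ _ h =>
    simp only [Link.Instance] at hi
    cases m with
    | concat =>
      have hs := h.sort_concat
      rw [sort_occString] at hs
      simp only [hi, Formula.WF, Formula.sort]
      exact ⟨⟨hb, hc', by omega⟩, by omega⟩
    | wrap k =>
      obtain ⟨hs, hk⟩ := h.sort_wrap
      rw [sort_occString] at hs hk
      simp only [hi, Formula.WF, Formula.sort]
      exact ⟨⟨hb, hc', by omega, hk⟩, by omega⟩

/-- The string of a proof of a product `A • B` has the sort of the string of the two hypotheses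
`A` and `B`. -/
lemma sort_comp_occString {m : Mode} {p a b : V} {ζ : Str (V × ℕ)}
    (hi : (Link.prodL m p a b).Instance label)
    (h : Comp 0 m (occString σ label a) (occString σ label b) ζ) :
    Str.sort 0 ζ = (label p).sort σ := by
  simp only [Link.Instance] at hi
  rw [hi]
  cases m with
  | concat =>
    have := h.sort_concat
    simpa only [sort_occString, Formula.sort] using this
  | wrap k =>
    have := h.sort_wrap.1
    simp only [sort_occString] at this
    simp only [Formula.sort]
    omega

/-- All occurrences in a derivation are well-formed formulas, and its string has the sort of its
conclusion. -/
lemma Deriv.wf_sort (d : Deriv σ label cut H ω c L) :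
    (∀ v ∈ c ::ₘ Link.premsOf L, (label v).WF σ) ∧ Str.sort 0 ω = (label c).sort σ := by
  induction d with
  | ax v hv => exact ⟨by simpa using hv, sort_occString v⟩
  | tensor hl hi d₁ d₂ h ih₁ ih₂ =>
    have := hl.wf_sort hi h (ih₁.1 _ (Multiset.mem_cons_self _ _))
      (ih₂.1 _ (Multiset.mem_cons_self _ _)) ih₁.2 ih₂.2
    refine ⟨fun v hv => ?_, this.2⟩
    have h₁ := ih₁.1 v
    have h₂ := ih₂.1 v
    simp only [Link.premsOf_cons, Link.premsOf_add, hl.prems, Multiset.insert_eq_cons,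
      Multiset.mem_cons, Multiset.mem_add, Multiset.mem_singleton] at hv h₁ h₂
    rcases hv with rfl | hv
    · exact this.1
    · tauto
  | abs hl hi d ih =>
    have := hl.wf_sort hi (ih.1 _ (by rw [← d.balance]; simp)) (ih.1 _ (Multiset.mem_cons_self _ _))
      ih.2
    refine ⟨fun v hv => ?_, this.2⟩
    have h₁ := ih.1 v
    simp only [Link.premsOf_cons, hl.prems, Multiset.mem_cons, Multiset.mem_add,
      Multiset.mem_singleton] at hv h₁
    rcases hv with rfl | hv
    · exact this.1
    · tauto
  | prodE hi d₁ d₂ h ih₁ ih₂ =>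
    have hs := sort_comp_occString hi h
    refine ⟨fun v hv => ?_, ?_⟩
    · have h₁ := ih₁.1 v
      have h₂ := ih₂.1 v
      simp only [Link.premsOf_cons, Link.premsOf_add, Link.prems, Multiset.coe_singleton,
        Multiset.mem_cons, Multiset.mem_add, Multiset.mem_singleton] at hv h₁ h₂
      tauto
    · simp only [Str.sort_append] at ih₂ ⊢
      omega
  | subst hc d₁ d₂ ih₁ ih₂ =>
    refine ⟨fun v hv => ?_, ?_⟩
    · have h₁ := ih₁.1 v
      have h₂ := ih₂.1 v
      simp only [Link.premsOf_add, Multiset.mem_cons, Multiset.mem_add] at hv h₁ h₂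
      tauto
    · simp only [Str.sort_append, sort_occString] at ih₂ ⊢
      omega

lemma Deriv.isInstance (d : Deriv σ label cut H ω c L) : ∀ l ∈ L, l.Instance label := by
  induction d with
  | ax v hv => simp
  | tensor hl hi d₁ d₂ h ih₁ ih₂ =>
    simp only [Multiset.mem_cons, Multiset.mem_add]
    rintro l (rfl | h | h)
    exacts [hi, ih₁ l h, ih₂ l h]
  | abs hl hi d ih =>
    simp only [Multiset.mem_cons]
    rintro l (rfl | h)
    exacts [hi, ih l h]
  | prodE hi d₁ d₂ h ih₁ ih₂ =>
    simp only [Multiset.mem_cons, Multiset.mem_add]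
    rintro l (rfl | h | h)
    exacts [hi, ih₁ l h, ih₂ l h]
  | subst hc d₁ d₂ ih₁ ih₂ =>
    simp only [Multiset.mem_add]
    rintro l (h | h)
    exacts [ih₁ l h, ih₂ l h]

end

section
variable {At V : Type*} {σ : At → ℕ} {label : V → Formula At}
variable {cut : Prop} {H : Multiset V} {ω : Str (V × ℕ)} {c : V} {L : Multiset (Link V)}

/-! ### Elimination of substitutions -/

lemma Link.IsTensor.cons_premsOf {l : Link V} {m : Mode} {x y z : V} (hl : l.IsTensor m x y z)
    (L₁ L₂ : Multiset (Link V)) :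
    z ::ₘ premsOf (l ::ₘ (L₁ + L₂)) = z ::ₘ (x ::ₘ premsOf L₁ + y ::ₘ premsOf L₂) := by
  rw [premsOf_cons, hl.prems, premsOf_add, Multiset.insert_eq_cons]
  simp only [← Multiset.singleton_add]
  abel

lemma AbsRule.cons_premsOf {l : Link V} {c' c b : V} {γ ω : Str (V × ℕ)}
    (hl : AbsRule σ label l c' c b γ ω) (L : Multiset (Link V)) :
    c ::ₘ Link.premsOf (l ::ₘ L) = c ::ₘ c' ::ₘ Link.premsOf L := by
  rw [Link.premsOf_cons, hl.prems, Multiset.singleton_add]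

lemma Link.cons_premsOf_prodL (m : Mode) (p a b c : V) (L₁ L₂ : Multiset (Link V)) :
    c ::ₘ premsOf (.prodL m p a b ::ₘ (L₁ + L₂)) = p ::ₘ premsOf L₁ + c ::ₘ premsOf L₂ := by
  rw [premsOf_cons, premsOf_add, prems, Multiset.coe_singleton]
  simp only [← Multiset.singleton_add]
  abel

lemma Deriv.hyps_le (d : Deriv σ label cut H ω c L) : H ≤ c ::ₘ Link.premsOf L :=
  d.balance ▸ Multiset.le_add_right _ _

lemma Deriv.mem_hyps_of_mem (d : Deriv σ label cut H ω c L) {p : V × ℕ} (hp : Tok.var p ∈ ω) :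
    p.1 ∈ H := by
  rw [← Str.mem_vars, d.vars] at hp
  exact mem_of_mem_lettersOf hp

lemma fst_eq_of_mem_occString {v : V} {p : V × ℕ} (h : Tok.var p ∈ occString σ label v) :
    p.1 = v := by
  rw [← Str.mem_vars, vars_occString] at h
  exact mem_occLetters (Multiset.mem_coe.1 h)

lemma Deriv.of_eq {H' : Multiset V} {L' : Multiset (Link V)} {ω' : Str (V × ℕ)}
    (d : Deriv σ label cut H ω c L) (hH : H = H') (hω : ω = ω') (hL : L = L') :
    Deriv σ label cut H' ω' c L' := by
  subst hH hω hL
  exact d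

lemma AbsRule.subst {l : Link V} {c' c b : V} {γ ω : Str (V × ℕ)}
    (hl : AbsRule σ label l c' c b γ ω) {g : V × ℕ → Str (V × ℕ)}
    (hg : ∀ p, Str.sort 0 (g p) = 0) (hb : ∀ p, p.1 = b → g p = [Tok.var p]) :
    AbsRule σ label l c' c b (Str.subst g γ) (Str.subst g ω) := by
  have hs : Str.subst g (occString σ label b) = occString σ label b :=
    Str.subst_eq_self fun p hp => hb p (fst_eq_of_mem_occString hp)
  cases hl with
  | overR h => exact .overR (hs ▸ h.subst hg)
  | underR h => exact .underR (hs ▸ h.subst hg)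

/-- A proof `d₀` of `β : u` may be substituted for the hypothesis `u` of a derivation whose
occurrences are pairwise different: replace the letters of `u` by the parts of `β`. -/
lemma Deriv.substitute {H₀ : Multiset V} {β : Str (V × ℕ)} {u : V} {L₀ : Multiset (Link V)}
    (d₀ : Deriv σ label False H₀ β u L₀) {g : V × ℕ → Str (V × ℕ)}
    (hg : ∀ p, Str.sort 0 (g p) = 0) (hg' : ∀ p : V × ℕ, p.1 ≠ u → g p = [Tok.var p])
    (hu : Str.subst g (occString σ label u) = β)
    (d : Deriv σ label False H ω c L) (hn : (c ::ₘ Link.premsOf L).Nodup)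
    {K : Multiset V} (hK : H = u ::ₘ K) :
    Deriv σ label False (H₀ + K) (Str.subst g ω) c (L₀ + L) := by
  classical
  -- a derivation without the hypothesis `u` is not changed
  have key {H : Multiset V} {ω : Str (V × ℕ)} {c : V} {L : Multiset (Link V)}
      (d : Deriv σ label False H ω c L) (h : u ∉ H) : Str.subst g ω = ω :=
    Str.subst_eq_self fun p hp => hg' p fun e => h (e ▸ d.mem_hyps_of_mem hp)
  induction d generalizing K with
  | ax v hv =>
    obtain ⟨rfl, rfl⟩ : v = u ∧ K = 0 := by simpa [Multiset.singleton_eq_cons_iff] using hK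
    rw [hu]
    exact d₀.of_eq (add_zero _).symm rfl (add_zero _).symm
  | @tensor H₁ H₂ _ _ _ _ _ _ L₁ L₂ _ _ hl hi d₁ d₂ h ih₁ ih₂ =>
    rw [hl.cons_premsOf] at hn
    obtain ⟨hn₁, hn₂, hd⟩ := Multiset.nodup_add.1 (Multiset.nodup_cons.1 hn).2
    have hu' : u ∈ H₁ + H₂ := hK ▸ Multiset.mem_cons_self u K
    rcases Multiset.mem_add.1 hu' with h₁ | h₂
    · obtain ⟨K₁, rfl⟩ := Multiset.exists_cons_of_mem h₁
      rw [Multiset.cons_add, Multiset.cons_inj_right] at hK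
      subst hK
      have h₂ : u ∉ H₂ := fun h₂ => Multiset.disjoint_left.1 hd
        (Multiset.mem_of_le d₁.hyps_le h₁) (Multiset.mem_of_le d₂.hyps_le h₂)
      have h' := h.subst (s := 0) (s' := 0) hg
      rw [key d₂ h₂] at h'
      refine (Deriv.tensor hl hi (ih₁ hn₁ rfl) d₂ h').of_eq (add_assoc _ _ _) rfl ?_
      simp only [← Multiset.singleton_add]
      abel
    · obtain ⟨K₂, rfl⟩ := Multiset.exists_cons_of_mem h₂
      rw [Multiset.add_cons, Multiset.cons_inj_right] at hK
      subst hK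
      have h₁ : u ∉ H₁ := fun h₁ => Multiset.disjoint_left.1 hd
        (Multiset.mem_of_le d₁.hyps_le h₁) (Multiset.mem_of_le d₂.hyps_le h₂)
      have h' := h.subst (s := 0) (s' := 0) hg
      rw [key d₁ h₁] at h'
      refine (Deriv.tensor hl hi d₁ (ih₂ hn₂ rfl) h').of_eq (add_left_comm _ _ _) rfl ?_
      simp only [← Multiset.singleton_add]
      abel
  | @abs H _ _ _ _ b L _ hl hi d ih =>
    rw [hl.cons_premsOf] at hn
    have hn' := (Multiset.nodup_cons.1 hn).2
    subst hK
    have hb : b ≠ u := by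
      rintro rfl
      exact (Multiset.nodup_cons.1 (Multiset.nodup_of_le d.hyps_le hn')).1
        (Multiset.mem_cons_self _ _)
    refine (Deriv.abs (hl.subst hg fun p hp => hg' p (hp ▸ hb)) hi
      ((ih hn' (Multiset.cons_swap _ _ _)).of_eq (Multiset.add_cons _ _ _) rfl rfl)).of_eq
      rfl rfl ?_
    rw [Multiset.add_cons]
  | @prodE H₁ H₂ δ γ₁ ζ γ₂ p a b _ L₁ L₂ m hi d₁ d₂ h ih₁ ih₂ =>
    rw [Link.cons_premsOf_prodL] at hn
    obtain ⟨hn₁, hn₂, hd⟩ := Multiset.nodup_add.1 hn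
    have hu' : u ∈ H₁ + H₂ := hK ▸ Multiset.mem_cons_self u K
    simp only [Str.subst_append] at key ih₂ ⊢
    rcases Multiset.mem_add.1 hu' with h₁ | h₂
    · obtain ⟨K₁, rfl⟩ := Multiset.exists_cons_of_mem h₁
      rw [Multiset.cons_add, Multiset.cons_inj_right] at hK
      subst hK
      have h₂ : u ∉ a ::ₘ b ::ₘ H₂ := fun h₂ => Multiset.disjoint_left.1 hd
        (Multiset.mem_of_le d₁.hyps_le h₁) (Multiset.mem_of_le d₂.hyps_le h₂)
      have hγ {γ : Str (V × ℕ)} (hγ : ∀ p, Tok.var p ∈ γ → Tok.var p ∈ γ₁ ++ ζ ++ γ₂) :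
          Str.subst g γ = γ :=
        Str.subst_eq_self fun p hp => hg' p fun e => h₂ (e ▸ d₂.mem_hyps_of_mem (hγ p hp))
      rw [hγ (γ := γ₁) (by simp +contextual), hγ (γ := γ₂) (by simp +contextual)]
      refine (Deriv.prodE hi (ih₁ hn₁ rfl) d₂ h).of_eq (add_assoc _ _ _) rfl ?_
      simp only [← Multiset.singleton_add]
      abel
    · have h₂' : u ∈ a ::ₘ b ::ₘ H₂ := by simp [h₂]
      obtain ⟨K₂, rfl⟩ := Multiset.exists_cons_of_mem h₂
      rw [Multiset.add_cons, Multiset.cons_inj_right] at hK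
      subst hK
      have h₁ : u ∉ H₁ := fun h₁ => Multiset.disjoint_left.1 hd
        (Multiset.mem_of_le d₁.hyps_le h₁) (Multiset.mem_of_le d₂.hyps_le h₂')
      have hab : a ≠ u ∧ b ≠ u := by
        have := Multiset.nodup_of_le d₂.hyps_le hn₂
        simp only [Multiset.nodup_cons, Multiset.mem_cons, not_or] at this
        tauto
      have hs {v : V} (hv : v ≠ u) : Str.subst g (occString σ label v) = occString σ label v :=
        Str.subst_eq_self fun p hp => hg' p (fst_eq_of_mem_occString hp ▸ hv)
      have h' := h.subst (s := 0) (s' := 0) hg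
      rw [hs hab.1, hs hab.2] at h'
      rw [key d₁ h₁]
      have d₂' := ih₂ hn₂ (K := a ::ₘ b ::ₘ K₂)
        (by rw [Multiset.cons_swap b u, Multiset.cons_swap a u])
      refine (Deriv.prodE hi d₁ (d₂'.of_eq (H' := a ::ₘ b ::ₘ (H₀ + K₂)) (by simp) rfl rfl)
        h').of_eq (add_left_comm _ _ _) rfl ?_
      simp only [← Multiset.singleton_add]
      abel
  | subst hc => exact hc.elim

/-- In a derivation whose occurrences are pairwise different, substitutions can be eliminated. -/
lemma Deriv.subst_elim (d : Deriv σ label cut H ω c L) (hn : (c ::ₘ Link.premsOf L).Nodup) :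
    Deriv σ label False H ω c L := by
  induction d with
  | ax v hv => exact .ax v hv
  | tensor hl hi d₁ d₂ h ih₁ ih₂ =>
    rw [hl.cons_premsOf] at hn
    obtain ⟨hn₁, hn₂, -⟩ := Multiset.nodup_add.1 (Multiset.nodup_cons.1 hn).2
    exact .tensor hl hi (ih₁ hn₁) (ih₂ hn₂) h
  | abs hl hi d ih =>
    rw [hl.cons_premsOf] at hn
    exact .abs hl hi (ih (Multiset.nodup_cons.1 hn).2)
  | prodE hi d₁ d₂ h ih₁ ih₂ =>
    rw [Link.cons_premsOf_prodL] at hn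
    obtain ⟨hn₁, hn₂, -⟩ := Multiset.nodup_add.1 hn
    exact .prodE hi (ih₁ hn₁) (ih₂ hn₂) h
  | @subst H₁ H₂ β γ₁ γ₂ u c L₁ L₂ hc d₁ d₂ ih₁ ih₂ =>
    rw [Link.premsOf_add, add_comm, ← Multiset.cons_add] at hn
    obtain ⟨hn₂, hn₁, hd⟩ := Multiset.nodup_add.1 hn
    have hu := Multiset.mem_of_le d₂.hyps_le (Multiset.mem_cons_self u H₂)
    have d₁' := ih₁ (Multiset.nodup_cons.2 ⟨Multiset.disjoint_left.1 hd hu, hn₁⟩)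
    have d₂' := ih₂ hn₂
    obtain ⟨g, hg, hg', hβ⟩ := exists_subst_separated β (occLetters σ label u)
      (nodup_occLetters u) (by rw [d₁.wf_sort.2]; simp [occLetters])
    -- the letters of `u` occur only in the displayed part of the string
    have hvars := d₂.vars
    rw [Str.vars_append, Str.vars_append, vars_occString, lettersOf_cons, add_right_comm,
      add_comm] at hvars
    have hγ {γ : Str (V × ℕ)} (hγ : ∀ p, Tok.var p ∈ γ → Tok.var p ∈ γ₁ ++ γ₂) :
        Str.subst g γ = γ := by
      refine Str.subst_eq_self fun p hp => hg' p fun e => ?_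
      have hp' := hγ p hp
      rw [← Str.mem_vars, Str.vars_append, add_left_cancel hvars] at hp'
      have := mem_of_mem_lettersOf hp'
      rw [mem_occLetters e] at this
      exact (Multiset.nodup_cons.1 (Multiset.nodup_of_le d₂.hyps_le hn₂)).1 this
    refine (d₁'.substitute hg (fun p hp => hg' p fun h => hp (mem_occLetters h)) hβ d₂' hn₂
      rfl).of_eq rfl ?_ rfl
    rw [Str.subst_append, Str.subst_append, hγ (γ := γ₁) (by simp +contextual),
      hγ (γ := γ₂) (by simp +contextual)]
    exact congrArg (γ₁ ++ · ++ γ₂) hβ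

end

section
variable {At V : Type*} {σ : At → ℕ} {label : V → Formula At}

/-! ### From natural deduction proofs to derivations -/

lemma rename_hypString {f : ℕ → V} {x : ℕ} {A : Formula At} (h : label (f x) = A) :
    Str.rename (fun p : Letter => (f p.1, p.2)) (hypString σ x A) = occString σ label (f x) := by
  subst h
  rw [hypString, rename_separated, List.map_map, occString, occLetters]
  rfl

lemma rename_occString {h : V → ℕ} {v : V} :
    Str.rename (fun p => (h p.1, p.2)) (occString σ label v) = hypString σ (h v) (label v) := by
  rw [hypString, occString, occLetters, rename_separated, List.map_map]
  rfl

lemma Link.exists_mem_prems (l : Link V) : ∃ v, v ∈ l.prems := by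
  cases l <;> simp [prems]

lemma Link.mem_premsOf {L : Multiset (Link V)} {l : Link V} (hl : l ∈ L) {v : V}
    (hv : v ∈ l.prems) : v ∈ premsOf L :=
  Multiset.mem_bind.2 ⟨l, hl, hv⟩

lemma Link.mem_conclsOf {L : Multiset (Link V)} {l : Link V} (hl : l ∈ L) {v : V}
    (hv : v ∈ l.concls) : v ∈ conclsOf L :=
  Multiset.mem_bind.2 ⟨l, hl, hv⟩

lemma val_insert_union_of_disjoint {α : Type*} [DecidableEq α] {s t : Finset α} {a : α}
    (h : Disjoint s t)
    (ha : a ∉ s ∪ t) : (insert a (s ∪ t)).val = a ::ₘ (s.val + t.val) := by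
  rw [Finset.insert_val_of_notMem ha, ← Finset.disjUnion_eq_union _ _ h, Finset.disjUnion_val]

/-- The finite sets of occurrences and links which `ND.Corresponds` keeps track of, compared
with the multisets of a derivation. -/
structure Represents (σ : At → ℕ) (label : V → Formula At) (H : Multiset V) (ω : Str (V × ℕ))
    (c : V) (vs : Finset V) (ls : Finset (Link V)) : Prop where
  deriv : Deriv σ label False H ω c ls.val
  verts : vs.val = c ::ₘ Link.premsOf ls.val

namespace Represents
variable {H H₁ H₂ : Multiset V} {ω ω₁ ω₂ : Str (V × ℕ)} {c c₁ c₂ : V} {vs vs₁ vs₂ : Finset V}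
  {ls ls₁ ls₂ : Finset (Link V)}

lemma nodup (h : Represents σ label H ω c vs ls) : (c ::ₘ Link.premsOf ls.val).Nodup :=
  h.verts ▸ vs.nodup

lemma nodup_hyps (h : Represents σ label H ω c vs ls) : H.Nodup :=
  Multiset.nodup_of_le h.deriv.hyps_le h.nodup

lemma mem_prems (h : Represents σ label H ω c vs ls) {l : Link V} (hl : l ∈ ls) {v : V}
    (hv : v ∈ l.prems) : v ∈ vs := by
  rw [← Finset.mem_val, h.verts]
  exact Multiset.mem_cons_of_mem (Link.mem_premsOf hl hv)

lemma mem_concls (h : Represents σ label H ω c vs ls) {l : Link V} (hl : l ∈ ls) {v : V}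
    (hv : v ∈ l.concls) : v ∈ vs := by
  rw [← Finset.mem_val, h.verts, ← h.deriv.balance]
  exact Multiset.mem_add.2 (.inr (Link.mem_conclsOf hl hv))

lemma mem_hyps (h : Represents σ label H ω c vs ls) {v : V} (hv : v ∈ H) : v ∈ vs := by
  rw [← Finset.mem_val, h.verts]
  exact Multiset.mem_of_le h.deriv.hyps_le hv

lemma mem_concl (h : Represents σ label H ω c vs ls) : c ∈ vs := by
  rw [← Finset.mem_val, h.verts]
  exact Multiset.mem_cons_self _ _

lemma disjoint_links (h₁ : Represents σ label H₁ ω₁ c₁ vs₁ ls₁)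
    (h₂ : Represents σ label H₂ ω₂ c₂ vs₂ ls₂) (hd : Disjoint vs₁ vs₂) : Disjoint ls₁ ls₂ := by
  refine Finset.disjoint_left.2 fun l hl₁ hl₂ => ?_
  obtain ⟨v, hv⟩ := l.exists_mem_prems
  exact Finset.disjoint_left.1 hd (h₁.mem_prems hl₁ hv) (h₂.mem_prems hl₂ hv)

variable [DecidableEq V]

lemma tensor (h₁ : Represents σ label H₁ ω₁ c₁ vs₁ ls₁)
    (h₂ : Represents σ label H₂ ω₂ c₂ vs₂ ls₂) (hd : Disjoint vs₁ vs₂) (hc : c ∉ vs₁ ∪ vs₂)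
    {l : Link V} {m : Mode} (hl : l.IsTensor m c₁ c₂ c) (hi : l.Instance label)
    (h : Comp 0 m ω₁ ω₂ ω) :
    Represents σ label (H₁ + H₂) ω c (insert c (vs₁ ∪ vs₂)) (insert l (ls₁ ∪ ls₂)) := by
  have hlc : c ∈ l.concls := by
    have := hl.concls ▸ Multiset.mem_singleton_self c
    exact Multiset.mem_coe.1 this
  have hl' : l ∉ ls₁ ∪ ls₂ := fun hl' => hc <| Finset.mem_union.2 <|
    (Finset.mem_union.1 hl').imp (fun h => h₁.mem_concls h hlc) fun h => h₂.mem_concls h hlc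
  have hls := val_insert_union_of_disjoint (h₁.disjoint_links h₂ hd) hl'
  refine ⟨hls ▸ .tensor hl hi h₁.deriv h₂.deriv h, ?_⟩
  rw [hls, val_insert_union_of_disjoint hd hc, hl.cons_premsOf, h₁.verts, h₂.verts]

lemma abs {b : V} (h : Represents σ label (b ::ₘ H) ω₁ c₁ vs ls) (hc : c ∉ vs)
    {l : Link V} (hl : AbsRule σ label l c₁ c b ω ω₁) (hi : l.Instance label) :
    Represents σ label H ω c (insert c vs) (insert l ls) := by
  have hlc : c ∈ l.concls := by
    have : c ∈ ({c, b} : Multiset V) := by simp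
    exact Multiset.mem_coe.1 (hl.concls ▸ this)
  have hl' : l ∉ ls := fun hl' => hc (h.mem_concls hl' hlc)
  refine ⟨?_, ?_⟩ <;> rw [Finset.insert_val_of_notMem hl']
  · exact .abs hl hi h.deriv
  · rw [Finset.insert_val_of_notMem hc, hl.cons_premsOf, h.verts]

lemma prodE {γ₁ ζ γ₂ : Str (V × ℕ)} {a b : V} (h₁ : Represents σ label H₁ ω₁ c₁ vs₁ ls₁)
    (h₂ : Represents σ label (a ::ₘ b ::ₘ H₂) (γ₁ ++ ζ ++ γ₂) c vs₂ ls₂)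
    (hd : Disjoint vs₁ vs₂) {m : Mode} (hi : (Link.prodL m c₁ a b).Instance label)
    (h : Comp 0 m (occString σ label a) (occString σ label b) ζ) :
    Represents σ label (H₁ + H₂) (γ₁ ++ ω₁ ++ γ₂) c (vs₁ ∪ vs₂)
      (insert (.prodL m c₁ a b) (ls₁ ∪ ls₂)) := by
  -- the link has a premiss in `vs₁` and a conclusion in `vs₂`
  have hl' : .prodL m c₁ a b ∉ ls₁ ∪ ls₂ := fun hl' => by
    rcases Finset.mem_union.1 hl' with hl' | hl'
    · exact Finset.disjoint_left.1 hd (h₁.mem_concls hl' (List.mem_cons_self ..))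
        (h₂.mem_hyps (Multiset.mem_cons_self _ _))
    · exact Finset.disjoint_left.1 hd h₁.mem_concl (h₂.mem_prems hl' (List.mem_cons_self ..))
  have hls := val_insert_union_of_disjoint (h₁.disjoint_links h₂ hd) hl'
  refine ⟨hls ▸ .prodE hi h₁.deriv h₂.deriv h, ?_⟩
  rw [hls, Link.cons_premsOf_prodL, ← h₁.verts, ← h₂.verts, ← Finset.disjUnion_eq_union _ _ hd,
    Finset.disjUnion_val]

end Represents

lemma Comp.rename_letter {m : Mode} {α β ω : Str Letter} (h : Comp letterSort m α β ω)
    (f : ℕ → V) : Comp 0 m (Str.rename (fun p => (f p.1, p.2)) α)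
      (Str.rename (fun p => (f p.1, p.2)) β) (Str.rename (fun p => (f p.1, p.2)) ω) :=
  h.rename (g := fun p : Letter => (f p.1, p.2)) fun _ => rfl

/-- A proof of which the hypotheses `x` are the occurrences `f x` does not depend on the value of
`f` at a name `x` whose occurrence `b` is withdrawn. -/
lemma rename_update {Γ : Multiset (ℕ × Formula At)} {f : ℕ → V} {x : ℕ} {b : V}
    (hb : b ∉ Γ.map fun p => Function.update f x b p.1) :
    (∀ p ∈ Γ, Function.update f x b p.1 = f p.1) ∧
    (Γ.map fun p => Function.update f x b p.1) = Γ.map (fun p => f p.1) ∧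
    ∀ γ : Str Letter, (∀ p : V × ℕ,
        Tok.var p ∈ Str.rename (fun p => (Function.update f x b p.1, p.2)) γ →
          p.1 ∈ Γ.map fun p => Function.update f x b p.1) →
      Str.rename (fun p => (Function.update f x b p.1, p.2)) γ =
        Str.rename (fun p => (f p.1, p.2)) γ := by
  have hΓ : ∀ p ∈ Γ, Function.update f x b p.1 = f p.1 := fun p hp =>
    Function.update_of_ne (fun h => hb (Multiset.mem_map.2 ⟨p, hp, by rw [h]; simp⟩)) _ _
  refine ⟨hΓ, Multiset.map_congr rfl hΓ, fun γ hγ => Str.rename_congr fun p hp => ?_⟩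
  have : p.1 ≠ x := by
    intro h
    have := hγ _ (Str.mem_rename.2 ⟨p, hp, rfl⟩)
    simp only [h, Function.update_self] at this
    exact hb (by simpa using this)
  rw [Function.update_of_ne this]

/-- Names that determine their occurrences are different for disjoint sets of hypotheses. -/
lemma disjoint_names {H₁ H₂ : Multiset V} {h : V → ℕ} {f : ℕ → V}
    (hf : ∀ v ∈ H₁ + H₂, f (h v) = v) (hd : Disjoint H₁ H₂) :
    Disjoint (names (H₁.map fun v => (h v, label v))) (names (H₂.map fun v => (h v, label v))) := by
  simp only [names, Multiset.map_map, Function.comp_def]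
  refine Multiset.disjoint_left.2 fun {n} h₁ h₂ => ?_
  obtain ⟨v, hv, rfl⟩ := Multiset.mem_map.1 h₁
  obtain ⟨w, hw, hvw⟩ := Multiset.mem_map.1 h₂
  have : v = w := by
    rw [← hf v (by simp [hv]), ← hf w (by simp [hw]), hvw]
  exact Multiset.disjoint_left.1 hd hv (this ▸ hw)

/-- The letters of the context of `α ∗ β`, where `α` and `β` are the strings of the hypotheses
`a` and `b`, belong to the other hypotheses, because every letter is used once. -/
lemma Deriv.mem_hyps_of_comp {H : Multiset V} {γ₁ ζ γ₂ : Str (V × ℕ)} {a b c : V}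
    {L : Multiset (Link V)} {m : Mode} {cut : Prop}
    (d : Deriv σ label cut (a ::ₘ b ::ₘ H) (γ₁ ++ ζ ++ γ₂) c L)
    (h : Comp 0 m (occString σ label a) (occString σ label b) ζ) {p : V × ℕ}
    (hp : Tok.var p ∈ γ₁ ++ γ₂) : p.1 ∈ H := by
  classical
  have hd := d.vars
  simp only [Str.vars_append, h.vars, vars_occString, lettersOf_cons] at hd
  have : Str.vars (γ₁ ++ γ₂) = lettersOf σ label H := by
    ext q
    have := congrArg (Multiset.count q) hd
    simp only [Str.vars_append, Multiset.count_add] at this ⊢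
    omega
  rw [← Str.mem_vars, this] at hp
  exact mem_of_mem_lettersOf hp

variable [DecidableEq V]

/-- The proof structure of a natural deduction proof comes with a derivation. -/
lemma ND.Corresponds.represents {Γ : Multiset (ℕ × Formula At)} {γ : Str Letter}
    {C : Formula At} {d : ND σ Γ γ C} {vs : Finset V} {ls : Finset (Link V)} {f : ℕ → V} {c : V}
    (h : d.Corresponds label vs ls f c) :
    Represents σ label (Γ.map fun p => f p.1) (Str.rename (fun p => (f p.1, p.2)) γ) c vs ls ∧
      label c = C ∧ ∀ p ∈ Γ, label (f p.1) = p.2 := by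
  induction d generalizing vs ls f c with
  | ax x A hA =>
    obtain ⟨rfl, rfl, rfl, rfl⟩ := h
    refine ⟨⟨?_, rfl⟩, rfl, by simp⟩
    rw [rename_hypString rfl]
    exact .ax _ hA
  | overE m d₁ d₂ hd h' ih₁ ih₂ =>
    obtain ⟨vs₁, vs₂, ls₁, ls₂, c₁, c₂, h₁, h₂, hvs, hc, rfl, rfl, rfl⟩ := h
    obtain ⟨r₁, hc₁, hΓ₁⟩ := ih₁ h₁
    obtain ⟨r₂, rfl, hΓ₂⟩ := ih₂ h₂
    rw [Multiset.map_add]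
    exact ⟨r₁.tensor r₂ hvs hc (.overL ..) hc₁ (h'.rename_letter f), rfl,
      fun p hp => (Multiset.mem_add.1 hp).elim (hΓ₁ p) (hΓ₂ p)⟩
  | underE m d₁ d₂ hd h' ih₁ ih₂ =>
    obtain ⟨vs₁, vs₂, ls₁, ls₂, c₁, c₂, h₁, h₂, hvs, hc, rfl, rfl, rfl⟩ := h
    obtain ⟨r₁, rfl, hΓ₁⟩ := ih₁ h₁
    obtain ⟨r₂, hc₂, hΓ₂⟩ := ih₂ h₂
    rw [Multiset.map_add]
    exact ⟨r₁.tensor r₂ hvs hc (.underL ..) hc₂ (h'.rename_letter f), rfl,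
      fun p hp => (Multiset.mem_add.1 hp).elim (hΓ₁ p) (hΓ₂ p)⟩
  | prodI m d₁ d₂ hd h' ih₁ ih₂ =>
    obtain ⟨vs₁, vs₂, ls₁, ls₂, c₁, c₂, h₁, h₂, hvs, hc, hl, rfl, rfl⟩ := h
    obtain ⟨r₁, rfl, hΓ₁⟩ := ih₁ h₁
    obtain ⟨r₂, rfl, hΓ₂⟩ := ih₂ h₂
    rw [Multiset.map_add]
    exact ⟨r₁.tensor r₂ hvs hc (.prodR ..) hl (h'.rename_letter f), hl,
      fun p hp => (Multiset.mem_add.1 hp).elim (hΓ₁ p) (hΓ₂ p)⟩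
  | overI m x d h' ih =>
    obtain ⟨vs', ls', c', b, h, hc, hl, rfl, rfl⟩ := h
    obtain ⟨r, rfl, hΓ⟩ := ih h
    have hb : label (Function.update f x b x) = _ := hΓ _ (Multiset.mem_cons_self _ _)
    have hcomp := h'.rename_letter (Function.update f x b)
    rw [rename_hypString hb] at hcomp
    simp only [Function.update_self, Multiset.map_cons] at r hcomp hb
    subst hb
    have r' := r.abs hc (.overR hcomp) hl
    obtain ⟨e₁, e₂, e₃⟩ := rename_update (Multiset.nodup_cons.1 r.nodup_hyps).1
    rw [e₃ _ fun p => r'.deriv.mem_hyps_of_mem, e₂] at r'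
    exact ⟨r', hl, fun p hp => e₁ p hp ▸ hΓ p (Multiset.mem_cons_of_mem hp)⟩
  | underI m x d h' ih =>
    obtain ⟨vs', ls', c', b, h, hc, hl, rfl, rfl⟩ := h
    obtain ⟨r, rfl, hΓ⟩ := ih h
    have hb : label (Function.update f x b x) = _ := hΓ _ (Multiset.mem_cons_self _ _)
    have hcomp := h'.rename_letter (Function.update f x b)
    rw [rename_hypString hb] at hcomp
    simp only [Function.update_self, Multiset.map_cons] at r hcomp hb
    subst hb
    have r' := r.abs hc (.underR hcomp) hl
    obtain ⟨e₁, e₂, e₃⟩ := rename_update (Multiset.nodup_cons.1 r.nodup_hyps).1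
    rw [e₃ _ fun p => r'.deriv.mem_hyps_of_mem, e₂] at r'
    exact ⟨r', hl, fun p hp => e₁ p hp ▸ hΓ p (Multiset.mem_cons_of_mem hp)⟩
  | @prodE Γ Δ δ γ₁ ζ γ₂ A B C m x y d₁ d₂ hd h' ih₁ ih₂ =>
    obtain ⟨vs₁, vs₂, ls₁, ls₂, c₁, a, b, h₁, h₂, hvs, rfl, rfl⟩ := h
    obtain ⟨r₁, hc₁, hΓ₁⟩ := ih₁ h₁
    obtain ⟨r₂, rfl, hΓ₂⟩ := ih₂ h₂
    have ha := hΓ₂ (x, A) (by simp)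
    have hb := hΓ₂ (y, B) (by simp)
    have hcomp := h'.rename_letter (Function.update (Function.update f x a) y b)
    rw [rename_hypString ha, rename_hypString hb] at hcomp
    simp only [Str.rename_append, Multiset.map_cons, Function.update_self] at r₂ hcomp ha hb
    have hn := r₂.nodup_hyps
    have hxy : x ≠ y := by
      rintro rfl
      simp at hn
    rw [Function.update_of_ne hxy, Function.update_self] at r₂ hcomp ha hn
    simp only [Multiset.nodup_cons, Multiset.mem_cons, not_or] at hn
    subst ha hb
    obtain ⟨e₁, e₂, e₃⟩ := rename_update hn.2.1
    have hγ₁ := e₃ γ₁ fun p hp => r₂.deriv.mem_hyps_of_comp hcomp (by simp [hp])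
    have hγ₂ := e₃ γ₂ fun p hp => r₂.deriv.mem_hyps_of_comp hcomp (by simp [hp])
    rw [e₂, hγ₁, hγ₂] at r₂
    obtain ⟨e₁', e₂', e₃'⟩ := rename_update (e₂ ▸ hn.1.2)
    have hγ₁ := e₃' γ₁ fun p hp => r₂.deriv.mem_hyps_of_comp hcomp (by simp [hp])
    have hγ₂ := e₃' γ₂ fun p hp => r₂.deriv.mem_hyps_of_comp hcomp (by simp [hp])
    rw [e₂', hγ₁, hγ₂] at r₂
    rw [Multiset.map_add, Str.rename_append, Str.rename_append]
    refine ⟨r₁.prodE r₂ hvs hc₁ hcomp, rfl, fun p hp => ?_⟩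
    rcases Multiset.mem_add.1 hp with hp | hp
    · exact hΓ₁ p hp
    · rw [← e₁' p hp, ← e₁ p hp]
      exact hΓ₂ p (by simp [hp])

/-! ### From derivations to natural deduction proofs -/

/-- A derivation without substitutions whose occurrences are pairwise different is a natural
deduction proof, when the hypotheses `v` are given the names `h v`. -/
lemma Deriv.exists_nd {H : Multiset V} {ω : Str (V × ℕ)} {c : V} {L : Multiset (Link V)}
    (d : Deriv σ label False H ω c L) (hn : (c ::ₘ Link.premsOf L).Nodup) (h : V → ℕ) (f : ℕ → V)
    (hf : ∀ v ∈ H, f (h v) = v) :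
    ∃ (Γ : Multiset (ℕ × Formula At)) (γ : Str Letter) (C : Formula At) (d : ND σ Γ γ C),
      Γ = H.map (fun v => (h v, label v)) ∧ γ = Str.rename (fun p => (h p.1, p.2)) ω ∧
      C = label c ∧ d.Corresponds label (c ::ₘ Link.premsOf L).toFinset L.toFinset f c := by
  induction d generalizing h f with
  | ax v hv =>
    refine ⟨_, _, _, .ax (h v) (label v) hv, by simp, rename_occString.symm, rfl, ?_⟩
    exact ⟨by simp, by simp, hf v (by simp), rfl⟩
  | @tensor H₁ H₂ α β ω x y z L₁ L₂ l m hl hi d₁ d₂ hcomp ih₁ ih₂ =>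
    rw [hl.cons_premsOf] at hn
    obtain ⟨hz, hn'⟩ := Multiset.nodup_cons.1 hn
    obtain ⟨hn₁, hn₂, hd⟩ := Multiset.nodup_add.1 hn'
    obtain ⟨Γ₁, γ₁, C₁, e₁, rfl, rfl, hC₁, hc₁⟩ := ih₁ hn₁ h f fun v hv => hf v (by simp [hv])
    obtain ⟨Γ₂, γ₂, C₂, e₂, rfl, rfl, hC₂, hc₂⟩ := ih₂ hn₂ h f fun v hv => hf v (by simp [hv])
    have hcomp' : Comp letterSort m _ _ _ :=
      hcomp.rename (g := fun p => (h p.1, p.2)) fun _ => rfl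
    have hdis := disjoint_names (label := label) hf <| Multiset.disjoint_left.2 fun {v} hv hw =>
      Multiset.disjoint_left.1 hd (Multiset.mem_of_le d₁.hyps_le hv)
        (Multiset.mem_of_le d₂.hyps_le hw)
    have hvs : Disjoint (x ::ₘ Link.premsOf L₁).toFinset (y ::ₘ Link.premsOf L₂).toFinset :=
      Multiset.disjoint_toFinset.2 hd
    have hz' : z ∉ (x ::ₘ Link.premsOf L₁).toFinset ∪ (y ::ₘ Link.premsOf L₂).toFinset := by
      rwa [← Multiset.toFinset_add, Multiset.mem_toFinset]
    rw [hl.cons_premsOf, Multiset.toFinset_cons (a := z), Multiset.toFinset_add (x ::ₘ _),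
      Multiset.toFinset_cons (a := l), Multiset.toFinset_add L₁, Multiset.map_add]
    cases hl with
    | overL =>
      subst hC₂
      obtain rfl := hC₁.trans hi
      exact ⟨_, _, _, .overE m e₁ e₂ hdis hcomp', rfl, rfl, rfl,
        _, _, _, _, _, _, hc₁, hc₂, hvs, hz', rfl, rfl, rfl⟩
    | underL =>
      subst hC₁
      obtain rfl := hC₂.trans hi
      exact ⟨_, _, _, .underE m e₁ e₂ hdis hcomp', rfl, rfl, rfl,
        _, _, _, _, _, _, hc₁, hc₂, hvs, hz', rfl, rfl, rfl⟩
    | prodR =>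
      subst hC₁ hC₂
      exact ⟨_, _, _, .prodI m e₁ e₂ hdis hcomp', rfl, rfl, hi.symm,
        _, _, _, _, _, _, hc₁, hc₂, hvs, hz', hi, rfl, rfl⟩
  | @abs H γ ω c' c b L l hl hi d ih =>
    rw [hl.cons_premsOf] at hn
    obtain ⟨hc, hn'⟩ := Multiset.nodup_cons.1 hn
    have hb := (Multiset.nodup_cons.1 (Multiset.nodup_of_le d.hyps_le hn')).1
    obtain ⟨x, hx⟩ := Infinite.exists_notMem_finset (H.map h).toFinset
    rw [Multiset.mem_toFinset] at hx
    have hh : ∀ v ∈ H, Function.update h b x v = h v := fun v hv =>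
      Function.update_of_ne (fun e => hb (by rwa [← e])) _ _
    have hγ : Str.rename (fun p => (Function.update h b x p.1, p.2)) γ =
        Str.rename (fun p => (h p.1, p.2)) γ :=
      Str.rename_congr fun p hp => by rw [hh _ ((Deriv.abs hl hi d).mem_hyps_of_mem hp)]
    obtain ⟨Γ', γ', C', e, hΓ', rfl, rfl, hcor⟩ := ih hn' (Function.update h b x)
      (Function.update f x b) fun v hv => by
        rcases Multiset.mem_cons.1 hv with rfl | hv
        · simp
        · rw [hh v hv, Function.update_of_ne, hf v hv]
          exact fun e => hx (e ▸ Multiset.mem_map_of_mem h hv)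
    have hΓ : (H.map fun v => (Function.update h b x v, label v)) =
        H.map fun v => (h v, label v) := Multiset.map_congr rfl fun v hv => by rw [hh v hv]
    rw [Multiset.map_cons, Function.update_self, hΓ] at hΓ'
    subst hΓ'
    rw [hl.cons_premsOf, Multiset.toFinset_cons, Multiset.toFinset_cons (a := l)]
    rw [← Multiset.mem_toFinset] at hc
    cases hl with
    | @overR m _ _ _ _ _ hcomp =>
      have hcomp' : Comp letterSort m _ _ _ :=
        hcomp.rename (g := fun p => (Function.update h b x p.1, p.2)) fun _ => rfl
      rw [rename_occString, Function.update_self, hγ] at hcomp'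
      exact ⟨_, _, _, .overI m x e hcomp', rfl, rfl, hi.symm, _, _, _, _, hcor, hc, hi, rfl, rfl⟩
    | @underR m _ _ _ _ _ hcomp =>
      have hcomp' : Comp letterSort m _ _ _ :=
        hcomp.rename (g := fun p => (Function.update h b x p.1, p.2)) fun _ => rfl
      rw [rename_occString, Function.update_self, hγ] at hcomp'
      exact ⟨_, _, _, .underI m x e hcomp', rfl, rfl, hi.symm, _, _, _, _, hcor, hc, hi, rfl, rfl⟩
  | @prodE H₁ H₂ δ γ₁ ζ γ₂ p a b _ L₁ L₂ m hi d₁ d₂ hcomp ih₁ ih₂ =>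
    rw [Link.cons_premsOf_prodL] at hn
    obtain ⟨hn₁, hn₂, hd⟩ := Multiset.nodup_add.1 hn
    have hab := Multiset.nodup_of_le d₂.hyps_le hn₂
    simp only [Multiset.nodup_cons, Multiset.mem_cons, not_or] at hab
    have hdis := disjoint_names (label := label) hf <| Multiset.disjoint_left.2 fun {v} hv hw =>
      Multiset.disjoint_left.1 hd (Multiset.mem_of_le d₁.hyps_le hv)
        (Multiset.mem_of_le d₂.hyps_le (by simp [hw]))
    obtain ⟨x, hx⟩ := Infinite.exists_notMem_finset (H₂.map h).toFinset
    obtain ⟨y, hy⟩ := Infinite.exists_notMem_finset (x ::ₘ H₂.map h).toFinset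
    rw [Multiset.mem_toFinset] at hx hy
    rw [Multiset.mem_cons, not_or] at hy
    set h' := Function.update (Function.update h a x) b y with hh'
    have ha : h' a = x := by simp [hh', Function.update_of_ne hab.1.1]
    have hb : h' b = y := by simp [hh']
    have hh : ∀ v ∈ H₂, h' v = h v := fun v hv => by
      have hva : v ≠ a := fun e => hab.1.2 (e ▸ hv)
      have hvb : v ≠ b := fun e => hab.2.1 (e ▸ hv)
      rw [hh', Function.update_of_ne hvb, Function.update_of_ne hva]
    have hγ {γ : Str (V × ℕ)} (hγ : ∀ p, Tok.var p ∈ γ → Tok.var p ∈ γ₁ ++ γ₂) :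
        Str.rename (fun p => (h' p.1, p.2)) γ = Str.rename (fun p => (h p.1, p.2)) γ :=
      Str.rename_congr fun p hp => by rw [hh _ (d₂.mem_hyps_of_comp hcomp (hγ p hp))]
    obtain ⟨Γ₁, δ', C₁, e₁, rfl, rfl, hC₁, hc₁⟩ := ih₁ hn₁ h f fun v hv => hf v (by simp [hv])
    obtain ⟨Γ₂, γ', C₂, e₂, hΓ₂, hγ', rfl, hc₂⟩ := ih₂ hn₂ h'
      (Function.update (Function.update f x a) y b) fun v hv => by
        simp only [Multiset.mem_cons] at hv
        rcases hv with rfl | rfl | hv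
        · rw [ha, Function.update_of_ne (Ne.symm hy.1), Function.update_self]
        · rw [hb, Function.update_self]
        · rw [hh v hv, Function.update_of_ne, Function.update_of_ne, hf v (by simp [hv])]
          · exact fun e => hx (e ▸ Multiset.mem_map_of_mem h hv)
          · exact fun e => hy.2 (e ▸ Multiset.mem_map_of_mem h hv)
    have hΓ : (H₂.map fun v => (h' v, label v)) = H₂.map fun v => (h v, label v) :=
      Multiset.map_congr rfl fun v hv => by rw [hh v hv]
    simp only [Multiset.map_cons, ha, hb, hΓ] at hΓ₂
    rw [Str.rename_append, Str.rename_append, hγ (γ := γ₁) (by simp +contextual),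
      hγ (γ := γ₂) (by simp +contextual)] at hγ'
    subst hΓ₂ hγ'
    obtain rfl := hC₁.trans hi
    have hcomp' : Comp letterSort m _ _ _ :=
      hcomp.rename (g := fun p => (h' p.1, p.2)) fun _ => rfl
    rw [rename_occString, rename_occString, ha, hb] at hcomp'
    rw [Link.cons_premsOf_prodL, Multiset.toFinset_add (p ::ₘ _),
      Multiset.toFinset_cons (a := Link.prodL ..), Multiset.toFinset_add L₁, Multiset.map_add,
      Str.rename_append, Str.rename_append]
    exact ⟨_, _, _, .prodE m x y e₁ e₂ hdis hcomp', rfl, rfl, rfl,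
      _, _, _, _, _, _, _, hc₁, hc₂, Multiset.disjoint_toFinset.2 hd, rfl, rfl⟩
  | subst hc => exact hc.elim

end

/-! ### Contraction of the abstract proof structure of a derivation -/

lemma Step.add_right {W : Type*} {s : W → ℕ} {M N : Multiset (ALink W)} (h : Step s M N)
    (T : Multiset (ALink W)) : Step s (M + T) (N + T) := by
  rcases h with ⟨R, α₁, α₂, β, u, v, hv⟩ | ⟨R, k, α, β, ω, l, r, v, h, hv⟩ |
    ⟨R, m, β, ω, act, u, v, h, hv⟩ | ⟨R, m, γ, ω, act, u, v, h, hv⟩ |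
    ⟨R, m, γ₁, γ₂, ζ, actA, actB, v₁, v₂, h, hv⟩ <;> simp only [Multiset.cons_add]
  · exact .plus (R + T) α₁ α₂ β u v hv
  · exact .times (R + T) k α β ω l r v h hv
  · exact .under (R + T) m β ω act u v h hv
  · exact .over (R + T) m γ ω act u v h hv
  · exact .prod (R + T) m γ₁ γ₂ ζ actA actB v₁ v₂ h hv

/-- Parts of an abstract proof structure can be contracted independently. -/
lemma contracts_add {W : Type*} {s : W → ℕ} {M M' N N' : Multiset (ALink W)}
    (h : Relation.ReflTransGen (Step s) M N) (h' : Relation.ReflTransGen (Step s) M' N') :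
    Relation.ReflTransGen (Step s) (M + M') (N + N') := by
  have h₁ := h.lift (fun M => M + M') fun _ _ hs => hs.add_right M'
  have h₂ := h'.lift (fun M' => M' + N) fun _ _ hs => hs.add_right N
  simp only [add_comm _ N] at h₂
  exact h₁.trans h₂

section
variable {At V : Type*} {σ : At → ℕ}

/-- The letters of occurrences as vertices of an abstract proof structure. -/
def toVert (ω : Str (V × ℕ)) : Str (AVert V) := Str.rename (fun p => AVert.piece p.1 p.2) ω

@[simp] lemma toVert_append (α β : Str (V × ℕ)) : toVert (α ++ β) = toVert α ++ toVert β :=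
  Str.rename_append ..

lemma node_notMem_toVert (v : V) (ω : Str (V × ℕ)) : Tok.var (AVert.node v) ∉ toVert ω := by
  simp [toVert, Str.mem_rename]

variable (P : ProofStructure σ V)

lemma ProofStructure.pieces_eq (v : V) :
    P.pieces v = (occLetters σ P.label v).map fun p => AVert.piece p.1 p.2 := by
  rw [occLetters, List.map_map]
  rfl

lemma toVert_occString (v : V) : toVert (occString σ P.label v) = separated (P.pieces v) := by
  rw [P.pieces_eq, occString, toVert, rename_separated]

lemma Comp.toVert {m : Mode} {α β ω : Str (V × ℕ)} (h : Comp 0 m α β ω) :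
    Comp P.vertSort m (toVert α) (toVert β) (toVert ω) :=
  h.rename (g := fun p : V × ℕ => AVert.piece p.1 p.2) fun _ => rfl

/-- The comb which is added above an input `v`. -/
def ProofStructure.inputComb (v : V) : ALink (AVert V) :=
  .comb (separated (P.pieces v)) (.node v)

lemma contracts_tensorLink {m : Mode} {α β ω : Str (V × ℕ)} (h : Comp 0 m α β ω) {x y z : V}
    (hy : z ≠ y) :
    Relation.ReflTransGen (Step P.vertSort)
      ({.comb (toVert α) (.node x)} + {.comb (toVert β) (.node y)} +
        {ProofStructure.tensorLink m x y z}) {.comb (toVert ω) (.node z)} := by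
  cases m with
  | concat =>
    cases h
    have h₁ := Step.plus (s := P.vertSort) {.comb (toVert β) (.node y)} [] [.var (.node y)]
      (toVert α) (.node x) (.node z) (by simp [node_notMem_toVert, hy])
    have h₂ := Step.plus (s := P.vertSort) 0 (toVert α) [] (toVert β) (.node y) (.node z)
      (by simp [node_notMem_toVert])
    simp only [List.nil_append, List.append_nil, ← toVert_append] at h₁ h₂
    refine .head ?_ (.single h₂)
    convert h₁ using 1
    · simp only [← Multiset.singleton_add, ProofStructure.tensorLink]
      abel
    · rw [Multiset.cons_swap]
      rfl
  | wrap k =>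
    have := Step.times 0 k _ _ _ (.node x) (.node y) (.node z) (h.toVert P)
      (node_notMem_toVert _ _)
    exact .single this

lemma Link.IsTensor.absLink {l : Link V} {m : Mode} {x y z : V} (hl : l.IsTensor m x y z) :
    P.absLink l = ProofStructure.tensorLink m x y z := by
  cases hl <;> rfl

/-- A derivation without substitutions whose occurrences are pairwise different shows how to
contract the links of its proof structure and the combs of the inputs. -/
lemma Deriv.contracts {H : Multiset V} {ω : Str (V × ℕ)} {c : V} {L : Multiset (Link V)}
    (d : Deriv σ P.label False H ω c L) (hn : (c ::ₘ Link.premsOf L).Nodup) :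
    Relation.ReflTransGen (Step P.vertSort)
      (L.map P.absLink + (H + Link.activeOf L).map P.inputComb) {.comb (toVert ω) (.node c)} := by
  induction d with
  | ax v hv =>
    rw [toVert_occString]
    rfl
  | @tensor H₁ H₂ _ _ _ x y z L₁ L₂ l m hl hi d₁ d₂ h ih₁ ih₂ =>
    rw [hl.cons_premsOf] at hn
    obtain ⟨hz, hn'⟩ := Multiset.nodup_cons.1 hn
    obtain ⟨hn₁, hn₂, -⟩ := Multiset.nodup_add.1 hn'
    have hzy : z ≠ y := fun e => hz (by simp [e])
    have h' := contracts_add (contracts_add (ih₁ hn₁) (ih₂ hn₂)) (.refl (a := {P.absLink l}))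
    have e : (l ::ₘ (L₁ + L₂)).map P.absLink +
        (H₁ + H₂ + Link.activeOf (l ::ₘ (L₁ + L₂))).map P.inputComb =
        L₁.map P.absLink + (H₁ + Link.activeOf L₁).map P.inputComb +
          (L₂.map P.absLink + (H₂ + Link.activeOf L₂).map P.inputComb) + {P.absLink l} := by
      rw [Link.activeOf_cons, hl.active, zero_add]
      simp only [Link.activeOf_add, Multiset.map_add, ← Multiset.singleton_add,
        Multiset.map_singleton]
      abel
    rw [e]
    refine h'.trans ?_
    rw [hl.absLink P]
    exact contracts_tensorLink P h hzy
  | @abs H _ _ _ _ b L l hl hi d ih =>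
    rw [hl.cons_premsOf] at hn
    have h := contracts_add (ih (Multiset.nodup_cons.1 hn).2) (.refl (a := {P.absLink l}))
    have e : (l ::ₘ L).map P.absLink + (H + Link.activeOf (l ::ₘ L)).map P.inputComb =
        L.map P.absLink + (b ::ₘ H + Link.activeOf L).map P.inputComb + {P.absLink l} := by
      rw [Link.activeOf_cons, hl.active]
      simp only [Multiset.map_add, ← Multiset.singleton_add,
        Multiset.map_singleton]
      abel
    rw [e]
    refine h.tail ?_
    cases hl with
    | overR h =>
      have := h.toVert P
      rw [toVert_occString] at this
      exact .over 0 _ _ _ _ _ _ this (node_notMem_toVert _ _)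
    | underR h =>
      have := h.toVert P
      rw [toVert_occString] at this
      exact .under 0 _ _ _ _ _ _ this (node_notMem_toVert _ _)
  | @prodE H₁ H₂ δ γ₁ ζ γ₂ p a b c L₁ L₂ m hi d₁ d₂ h ih₁ ih₂ =>
    rw [Link.cons_premsOf_prodL] at hn
    obtain ⟨hn₁, hn₂, hd⟩ := Multiset.nodup_add.1 hn
    have hpc : c ≠ p := fun e => Multiset.disjoint_left.1 hd (Multiset.mem_cons_self _ _)
      (e ▸ Multiset.mem_cons_self _ _)
    have h' := contracts_add (ih₁ hn₁) (contracts_add (ih₂ hn₂)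
      (.refl (a := {P.absLink (.prodL m p a b)})))
    have e : (Link.prodL m p a b ::ₘ (L₁ + L₂)).map P.absLink +
        (H₁ + H₂ + Link.activeOf (Link.prodL m p a b ::ₘ (L₁ + L₂))).map P.inputComb =
        L₁.map P.absLink + (H₁ + Link.activeOf L₁).map P.inputComb + (L₂.map P.absLink +
          (a ::ₘ b ::ₘ H₂ + Link.activeOf L₂).map P.inputComb +
          {P.absLink (.prodL m p a b)}) := by
      simp only [Link.activeOf_cons, Link.activeOf_add, Link.active]
      simp only [← Multiset.cons_coe, Multiset.coe_nil, Multiset.map_add, ← Multiset.singleton_add, Multiset.map_singleton,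
        add_zero]
      abel
    rw [e]
    refine h'.trans ?_
    have hcomp := h.toVert P
    rw [toVert_occString, toVert_occString] at hcomp
    have h₁ := Step.prod (s := P.vertSort) 0 m (toVert γ₁) (toVert γ₂) _ _ _ (.node p) (.node c)
      hcomp (by simp [node_notMem_toVert, hpc])
    have h₂ := Step.plus (s := P.vertSort) 0 (toVert γ₁) (toVert γ₂) (toVert δ) (.node p) (.node c)
      (by simp [node_notMem_toVert])
    simp only [toVert_append]
    refine .trans (contracts_add .refl (.single h₁)) (.single h₂)
  | subst hc => exact hc.elim

end

/-! ### The vertices of a proof structure -/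

section
variable {At V : Type*} {σ : At → ℕ} (P : ProofStructure σ V)

namespace ProofStructure

lemma concls_mem {v : V} : v ∈ Link.conclsOf P.links.val ↔ ∃ l ∈ P.links, v ∈ l.concls := by
  simp [Link.conclsOf]

lemma prems_mem {v : V} : v ∈ Link.premsOf P.links.val ↔ ∃ l ∈ P.links, v ∈ l.prems := by
  simp [Link.premsOf]

variable [DecidableEq V]

lemma hyps_add_concls : P.hyps.val + Link.conclsOf P.links.val = P.verts.val := by
  refine (Multiset.Nodup.ext (Multiset.nodup_add.2 ⟨P.hyps.nodup, P.concls_nodup, ?_⟩)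
    P.verts.nodup).2 fun v => ?_
  · refine Multiset.disjoint_left.2 fun {v} hv hv' => ?_
    obtain ⟨l, hl, hvl⟩ := P.concls_mem.1 hv'
    exact (Finset.mem_filter.1 hv).2 l hl hvl
  · change v ∈ P.hyps.val + Link.conclsOf P.links.val ↔ _
    rw [Multiset.mem_add, P.concls_mem]
    constructor
    · rintro (hv | ⟨l, hl, hv⟩)
      · exact (Finset.mem_filter.1 hv).1
      · exact P.mem_verts l hl v (by simp [hv])
    · intro hv
      by_cases h : ∃ l ∈ P.links, v ∈ l.concls
      · exact .inr h
      · exact .inl (Finset.mem_filter.2 ⟨hv, by simpa using h⟩)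

lemma conclusions_add_prems :
    P.conclusions.val + Link.premsOf P.links.val = P.verts.val := by
  refine (Multiset.Nodup.ext (Multiset.nodup_add.2 ⟨P.conclusions.nodup, P.prems_nodup, ?_⟩)
    P.verts.nodup).2 fun v => ?_
  · refine Multiset.disjoint_left.2 fun {v} hv hv' => ?_
    obtain ⟨l, hl, hvl⟩ := P.prems_mem.1 hv'
    exact (Finset.mem_filter.1 hv).2 l hl hvl
  · change v ∈ P.conclusions.val + Link.premsOf P.links.val ↔ _
    rw [Multiset.mem_add, P.prems_mem]
    constructor
    · rintro (hv | ⟨l, hl, hv⟩)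
      · exact (Finset.mem_filter.1 hv).1
      · exact P.mem_verts l hl v (by simp [hv])
    · intro hv
      by_cases h : ∃ l ∈ P.links, v ∈ l.prems
      · exact .inr h
      · exact .inl (Finset.mem_filter.2 ⟨hv, by simpa using h⟩)

lemma inputs_val : P.inputs.val = P.hyps.val + Link.activeOf P.links.val := by
  have hd : Disjoint P.hyps.val (Link.conclsOf P.links.val) :=
    (Multiset.nodup_add.1 (P.hyps_add_concls ▸ P.verts.nodup)).2.2
  refine (Multiset.Nodup.ext P.inputs.nodup (Multiset.nodup_add.2 ⟨P.hyps.nodup,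
    Multiset.nodup_of_le (Link.activeOf_le _) P.concls_nodup,
    hd.mono_right (Link.activeOf_le _)⟩)).2 fun v => ?_
  simp only [inputs, Finset.mem_val, Finset.mem_union, Finset.mem_filter, Multiset.mem_add,
    Link.activeOf, Multiset.mem_bind, Multiset.mem_coe]
  refine or_congr_right ⟨And.right, fun h => ⟨?_, h⟩⟩
  obtain ⟨l, hl, hv⟩ := h
  exact P.mem_verts l hl v (List.mem_append_right _ (l.active_subset hv))

lemma abstract_eq : P.abstract = P.links.val.map P.absLink +
    (P.hyps.val + Link.activeOf P.links.val).map P.inputComb := by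
  rw [← inputs_val]
  rfl

end ProofStructure
end

/-! ### A quantity which contractions preserve -/

namespace ALink
variable {W : Type*}

/-- The conclusions of a link of an abstract proof structure, including the vertices which
replace active conclusions. -/
def outs : ALink W → Multiset W
  | comb _ c => {c}
  | wrap _ _ _ c => {c}
  | parOver _ _ main act => main ::ₘ act
  | parUnder _ _ act main => main ::ₘ act
  | parProd _ _ actA actB => actA + actB

/-- The premisses of a link of an abstract proof structure. -/
def ins : ALink W → Multiset W
  | comb ps _ => Str.vars ps
  | wrap _ l r _ => {l, r}
  | parOver _ prem _ _ => {prem}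
  | parUnder _ prem _ _ => {prem}
  | parProd _ main _ _ => {main}

end ALink

/-- A contraction removes the same vertices from the premisses as from the conclusions. -/
lemma Step.balance {W : Type*} {s : W → ℕ} {M N : Multiset (ALink W)} (h : Step s M N) :
    N.bind ALink.outs + M.bind ALink.ins = M.bind ALink.outs + N.bind ALink.ins := by
  classical
  rcases h with ⟨R, α₁, α₂, β, u, v, -⟩ | ⟨R, k, α, β, ω, l, r, v, h, -⟩ |
    ⟨R, m, β, ω, act, u, v, h, -⟩ | ⟨R, m, γ, ω, act, u, v, h, -⟩ |
    ⟨R, m, γ₁, γ₂, ζ, actA, actB, v₁, v₂, h, -⟩ <;>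
  simp only [Multiset.cons_bind, ALink.outs, ALink.ins, Str.vars_append, Str.vars,
    Multiset.insert_eq_cons]
  all_goals
    try simp only [h.vars, Str.vars_separated]
    ext x
    simp only [← Multiset.singleton_add, Multiset.count_add]
    omega

lemma contracts_balance {W : Type*} {s : W → ℕ} {M N : Multiset (ALink W)}
    (h : Relation.ReflTransGen (Step s) M N) :
    N.bind ALink.outs + M.bind ALink.ins = M.bind ALink.outs + N.bind ALink.ins := by
  classical
  induction h with
  | refl => rfl
  | tail _ hs ih =>
    have := hs.balance
    ext x
    have h₁ := congrArg (Multiset.count x) ih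
    have h₂ := congrArg (Multiset.count x) this
    simp only [Multiset.count_add] at h₁ h₂ ⊢
    omega

section
variable {At V : Type*} {σ : At → ℕ} (P : ProofStructure σ V)

lemma ProofStructure.ins_absLink (l : Link V) :
    (P.absLink l).ins = (l.prems : Multiset V).map AVert.node := by
  cases l with
  | overL m | underL m | prodR m => cases m <;> rfl
  | overR | underR | prodL => rfl

lemma ProofStructure.outs_absLink (l : Link V) :
    (P.absLink l).outs + (l.active : Multiset V).map AVert.node =
      (l.concls : Multiset V).map AVert.node +
        (l.active : Multiset V).bind fun v => (P.pieces v : Multiset (AVert V)) := by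
  cases l with
  | overL m | underL m | prodR m => cases m <;> rfl
  | overR | underR | prodL =>
    simp [ProofStructure.absLink, ALink.outs, Link.active, Link.concls, ← Multiset.cons_coe,
      ← Multiset.singleton_add]
    try abel

lemma ProofStructure.ins_links (L : Multiset (Link V)) :
    (L.map P.absLink).bind ALink.ins = (Link.premsOf L).map AVert.node := by
  induction L using Multiset.induction with
  | empty => rfl
  | cons l L ih =>
    rw [Multiset.map_cons, Multiset.cons_bind, ih, P.ins_absLink, Link.premsOf_cons,
      Multiset.map_add]

lemma ProofStructure.outs_links (L : Multiset (Link V)) :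
    (L.map P.absLink).bind ALink.outs + (Link.activeOf L).map AVert.node =
      (Link.conclsOf L).map AVert.node +
        (Link.activeOf L).bind fun v => (P.pieces v : Multiset (AVert V)) := by
  induction L using Multiset.induction with
  | empty => rfl
  | cons l L ih =>
    rw [Multiset.map_cons, Multiset.cons_bind, Link.activeOf_cons, Link.conclsOf_cons,
      Multiset.map_add, Multiset.map_add, Multiset.add_bind, add_add_add_comm, ih, P.outs_absLink]
    abel

lemma ProofStructure.ins_inputs (S : Multiset V) :
    (S.map P.inputComb).bind ALink.ins = S.bind fun v => (P.pieces v : Multiset (AVert V)) := by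
  rw [Multiset.bind, Multiset.map_map]
  exact Multiset.bind_congr fun v _ => Str.vars_separated _

lemma ProofStructure.outs_inputs (S : Multiset V) :
    (S.map P.inputComb).bind ALink.outs = S.map AVert.node := by
  rw [Multiset.bind, Multiset.map_map]
  exact Multiset.bind_singleton S AVert.node

variable [DecidableEq V]

/-- If the abstract proof structure of `P` contracts to a single comb, then the conclusion of the
comb is the only vertex of `P` which is not a premiss. -/
lemma ProofStructure.ContractsTo.verts_eq {ω : Str (AVert V)} {c : V}
    (h : P.ContractsTo ω (.node c)) :
    (∀ v, Tok.var (AVert.node v) ∉ ω) ∧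
      P.verts.val = c ::ₘ Link.premsOf P.links.val := by
  classical
  have hb := contracts_balance h.1
  rw [P.abstract_eq, Multiset.add_bind, Multiset.add_bind, P.ins_links, P.ins_inputs,
    P.outs_inputs, Multiset.singleton_bind, Multiset.singleton_bind, Multiset.map_add,
    Multiset.add_bind] at hb
  have ho := P.outs_links P.links.val
  have hv := congrArg (Multiset.map AVert.node) P.hyps_add_concls
  rw [Multiset.map_add] at hv
  have hp (S : Multiset V) (v : V) :
      (S.bind fun v => (P.pieces v : Multiset (AVert V))).count (.node v) = 0 := by
    refine Multiset.count_eq_zero.2 fun h => ?_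
    obtain ⟨u, -, hu⟩ := Multiset.mem_bind.1 h
    simp [ProofStructure.pieces] at hu
  have hi : Function.Injective (AVert.node (V := V)) := fun _ _ => AVert.node.inj
  have key (v : V) : (P.verts.val.count v) + (Str.vars ω).count (.node v) =
      (c ::ₘ Link.premsOf P.links.val).count v := by
    have h₁ := congrArg (Multiset.count (AVert.node v)) hb
    have h₂ := congrArg (Multiset.count (AVert.node v)) ho
    have h₃ := congrArg (Multiset.count (AVert.node v)) hv
    rw [← Multiset.count_map_eq_count' AVert.node _ hi, ← Multiset.count_map_eq_count' AVert.node
      (c ::ₘ _) hi, Multiset.map_cons, ← Multiset.singleton_add]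
    simp only [Multiset.count_add, hp, ALink.outs, ALink.ins] at h₁ h₂ h₃ ⊢
    omega
  have hω (v : V) : Tok.var (AVert.node v) ∉ ω := by
    intro hv
    have hvc : v ≠ c := fun e => h.2 (e ▸ hv)
    have h₀ := key v
    rw [Multiset.count_cons_of_ne hvc] at h₀
    have h₁ : 0 < (Str.vars ω).count (.node v) :=
      Multiset.count_pos.2 (Str.mem_vars.2 hv)
    have h₂ := Multiset.nodup_iff_count_le_one.1 P.prems_nodup v
    change (Link.premsOf P.links.val).count v ≤ 1 at h₂
    -- `v` is a premiss of a link, hence one of the vertices of `P`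
    obtain ⟨l, hl, hvl⟩ := P.prems_mem.1 (Multiset.count_pos.1 (by omega : 0 <
      (Link.premsOf P.links.val).count v))
    have h₃ : 0 < P.verts.val.count v :=
      Multiset.count_pos.2 (P.mem_verts l hl v (List.mem_append_left _ hvl))
    omega
  refine ⟨hω, Multiset.ext.2 fun v => ?_⟩
  rw [← key v, Multiset.count_eq_zero.2 fun h => hω v (Str.mem_vars.1 h), add_zero]

end

section
variable {At V : Type*} {σ : At → ℕ} (P : ProofStructure σ V)

/-! ### The derivations behind the combs of a contraction sequence -/

lemma Str.subst_rename {W W' W'' : Type*} (f : W → W') (g : W' → Str W'') (α : Str W) :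
    Str.subst g (Str.rename f α) = Str.subst (fun w => g (f w)) α := by
  induction α with
  | nil => rfl
  | cons t α ih =>
    cases t with
    | sep => exact congrArg (List.cons Tok.sep) ih
    | var w => exact congrArg (g (f w) ++ ·) ih

/-- The string of the proof before the withdrawal shows that `b` is one of its hypotheses. -/
lemma Deriv.exists_cons_of_absRule {label : V → Formula At} {cut : Prop}
    {H : Multiset V} {γ ω : Str (V × ℕ)} {c' c b : V} {L : Multiset (Link V)} {l : Link V}
    (d : Deriv σ label cut H ω c' L) (hl : AbsRule σ label l c' c b γ ω) :
    ∃ K, H = b ::ₘ K := by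
  refine Multiset.exists_cons_of_mem (d.mem_hyps_of_mem (p := (b, 0)) ?_)
  rw [← Str.mem_vars, hl.vars]
  exact Multiset.mem_add.2 (.inl (Multiset.mem_coe.2 (zero_mem_occLetters b)))

namespace ProofStructure

/-- A vertex which is an occurrence `v` of sort `n` stands for `v₀ + 1 + ⋯ + 1 + vₙ`. -/
def expandVert : AVert V → Str (V × ℕ)
  | .node v => occString σ P.label v
  | .piece v i => [.var (v, i)]

/-- The string over the letters of occurrences which a list of premisses of a comb stands for. -/
def expand (ω : Str (AVert V)) : Str (V × ℕ) := Str.subst P.expandVert ω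

@[simp] lemma expand_append (α β : Str (AVert V)) :
    P.expand (α ++ β) = P.expand α ++ P.expand β := Str.subst_append ..

lemma expand_node_cons (v : V) (α : Str (AVert V)) :
    P.expand (.var (.node v) :: α) = occString σ P.label v ++ P.expand α := rfl

@[simp] lemma expand_nil : P.expand [] = [] := rfl

lemma sort_expandVert (w : AVert V) : Str.sort 0 (P.expandVert w) = P.vertSort w := by
  cases w with
  | node v => exact sort_occString v
  | piece v i => rfl

lemma expand_comp {m : Mode} {α β ω : Str (AVert V)} (h : Comp P.vertSort m α β ω) :
    Comp 0 m (P.expand α) (P.expand β) (P.expand ω) :=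
  h.subst P.sort_expandVert

lemma expand_toVert (ω : Str (V × ℕ)) : P.expand (toVert ω) = ω := by
  rw [toVert, expand, Str.subst_rename]
  exact Str.subst_eq_self fun _ _ => rfl

lemma expand_pieces (v : V) : P.expand (separated (P.pieces v)) = occString σ P.label v := by
  rw [← toVert_occString, expand_toVert]

lemma toVert_expand {ω : Str (AVert V)} (h : ∀ v, Tok.var (AVert.node v) ∉ ω) :
    toVert (P.expand ω) = ω := by
  induction ω with
  | nil => rfl
  | cons t ω ih =>
    have ih := ih fun v hv => h v (List.mem_cons_of_mem _ hv)
    match t with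
    | .sep => exact congrArg (List.cons Tok.sep) ih
    | .var (.piece v i) => exact congrArg (List.cons (Tok.var (AVert.piece v i))) ih
    | .var (.node v) => exact (h v List.mem_cons_self).elim

/-- `P.Justified a L`: the link `a` of a partially contracted abstract proof structure of `P` comes
from the links `L` of `P`. A comb comes from a derivation, any other link from a single link. -/
def Justified : ALink (AVert V) → Multiset (Link V) → Prop
  | .comb ps w, L => ∃ c H, w = .node c ∧ Deriv σ P.label True H (P.expand ps) c L
  | a, L => ∃ l ∈ P.links, P.absLink l = a ∧ L = {l}

/-- All links of a partially contracted abstract proof structure are justified, where each link of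
`P` is used once. -/
def AllJustified (M : Multiset (ALink (AVert V))) : Prop :=
  ∃ Ls : Multiset (Multiset (Link V)), Multiset.Rel P.Justified M Ls ∧ Ls.sum = P.links.val

lemma isTensor_of_absLink {l : Link V} {k : Pos} {x y z : AVert V}
    (h : P.absLink l = .wrap k x y z) : ∃ x' y' z', l.IsTensor (.wrap k) x' y' z' ∧
      x = .node x' ∧ y = .node y' ∧ z = .node z' := by
  cases l with
  | overL m =>
    cases m with
    | concat => cases h
    | wrap => cases h; exact ⟨_, _, _, .overL .., rfl, rfl, rfl⟩
  | underL m =>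
    cases m with
    | concat => cases h
    | wrap => cases h; exact ⟨_, _, _, .underL .., rfl, rfl, rfl⟩
  | prodR m =>
    cases m with
    | concat => cases h
    | wrap => cases h; exact ⟨_, _, _, .prodR .., rfl, rfl, rfl⟩
  | overR | underR | prodL => cases h

lemma tensorLink_ne_parOver {m m' : Mode} {x y z : V} {u v : AVert V} {act : List (AVert V)} :
    tensorLink m x y z ≠ .parOver m' u v act := by
  cases m <;> simp [tensorLink]

lemma tensorLink_ne_parUnder {m m' : Mode} {x y z : V} {u v : AVert V} {act : List (AVert V)} :
    tensorLink m x y z ≠ .parUnder m' u act v := by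
  cases m <;> simp [tensorLink]

lemma tensorLink_ne_parProd {m m' : Mode} {x y z : V} {v : AVert V} {A B : List (AVert V)} :
    tensorLink m x y z ≠ .parProd m' v A B := by
  cases m <;> simp [tensorLink]

lemma eq_overR_of_absLink {l : Link V} {m : Mode} {u v : AVert V} {act : List (AVert V)}
    (h : P.absLink l = .parOver m u v act) :
    ∃ c f b, l = .overR m c f b ∧ u = .node c ∧ v = .node f ∧ act = P.pieces b := by
  cases l with
  | overL | underL | prodR => exact (tensorLink_ne_parOver h).elim
  | overR => cases h; exact ⟨_, _, _, rfl, rfl, rfl, rfl⟩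
  | underR | prodL => cases h

lemma eq_underR_of_absLink {l : Link V} {m : Mode} {u v : AVert V} {act : List (AVert V)}
    (h : P.absLink l = .parUnder m u act v) :
    ∃ c a f, l = .underR m c a f ∧ u = .node c ∧ v = .node f ∧ act = P.pieces a := by
  cases l with
  | overL | underL | prodR => exact (tensorLink_ne_parUnder h).elim
  | underR => cases h; exact ⟨_, _, _, rfl, rfl, rfl, rfl⟩
  | overR | prodL => cases h

lemma eq_prodL_of_absLink {l : Link V} {m : Mode} {v : AVert V} {A B : List (AVert V)}
    (h : P.absLink l = .parProd m v A B) :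
    ∃ p a b, l = .prodL m p a b ∧ v = .node p ∧ A = P.pieces a ∧ B = P.pieces b := by
  cases l with
  | overL | underL | prodR => exact (tensorLink_ne_parProd h).elim
  | prodL => cases h; exact ⟨_, _, _, rfl, rfl, rfl, rfl⟩
  | overR | underR => cases h

/-- Contraction steps preserve justification: `[+]` is a substitution, the other contractions are
the rules of natural deduction. -/
lemma AllJustified.step {M N : Multiset (ALink (AVert V))} (h : P.AllJustified M)
    (hs : Step P.vertSort M N) : P.AllJustified N := by
  obtain ⟨Ls, hr, hL⟩ := h
  rcases hs with ⟨R, α₁, α₂, β, u, v, -⟩ | ⟨R, k, α, β, ω, l, r, v, h, -⟩ |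
    ⟨R, m, β, ω, act, u, v, h, -⟩ | ⟨R, m, γ, ω, act, u, v, h, -⟩ |
    ⟨R, m, γ₁, γ₂, ζ, actA, actB, v₁, v₂, h, -⟩
  · obtain ⟨L₁, _, g₁, hr₁, rfl⟩ := Multiset.rel_cons_left.1 hr
    obtain ⟨L₂, T, g₂, hT, rfl⟩ := Multiset.rel_cons_left.1 hr₁
    obtain ⟨c₁, H₁, rfl, d₁⟩ := g₁
    obtain ⟨c₂, H₂, rfl, d₂⟩ := g₂
    rw [expand_append, expand_node_cons, ← List.append_assoc] at d₂
    obtain ⟨K, rfl⟩ := Multiset.exists_cons_of_mem (d₂.mem_hyps_of_mem (p := (c₁, 0)) (by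
      rw [← Str.mem_vars, Str.vars_append, Str.vars_append, vars_occString]
      simp [zero_mem_occLetters]))
    refine ⟨(L₁ + L₂) ::ₘ T, hT.cons ⟨c₂, H₁ + K, rfl, ?_⟩, ?_⟩
    · rw [expand_append, expand_append]
      exact .subst trivial d₁ d₂
    · rw [← hL]
      simp [add_assoc]
  · obtain ⟨L₁, _, g₁, hr₁, rfl⟩ := Multiset.rel_cons_left.1 hr
    obtain ⟨L₂, _, g₂, hr₂, rfl⟩ := Multiset.rel_cons_left.1 hr₁
    obtain ⟨L₃, T, g₃, hT, rfl⟩ := Multiset.rel_cons_left.1 hr₂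
    obtain ⟨c₁, H₁, rfl, d₁⟩ := g₁
    obtain ⟨c₂, H₂, rfl, d₂⟩ := g₂
    obtain ⟨l, hl, hla, rfl⟩ := g₃
    obtain ⟨x, y, z, ht, hx, hy, rfl⟩ := P.isTensor_of_absLink hla
    cases hx
    cases hy
    refine ⟨(l ::ₘ (L₁ + L₂)) ::ₘ T, hT.cons ⟨z, H₁ + H₂, rfl,
      .tensor ht (P.isInstance l hl) d₁ d₂ (P.expand_comp h)⟩, ?_⟩
    rw [← hL]
    simp only [Multiset.sum_cons]
    simp only [← Multiset.singleton_add]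
    abel
  · obtain ⟨L₁, _, g₁, hr₁, rfl⟩ := Multiset.rel_cons_left.1 hr
    obtain ⟨L₂, T, g₂, hT, rfl⟩ := Multiset.rel_cons_left.1 hr₁
    obtain ⟨c₁, H, rfl, d⟩ := g₁
    obtain ⟨l, hl, hla, rfl⟩ := g₂
    obtain ⟨c, a, f, rfl, hc, rfl, rfl⟩ := P.eq_underR_of_absLink hla
    cases hc
    have h' := P.expand_comp h
    rw [expand_pieces] at h'
    have ha : AbsRule σ P.label (.underR m c₁ a f) c₁ f a _ _ := .underR h'
    obtain ⟨K, rfl⟩ := d.exists_cons_of_absRule ha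
    refine ⟨(_ ::ₘ L₁) ::ₘ T, hT.cons ⟨f, K, rfl, .abs ha (P.isInstance _ hl) d⟩, ?_⟩
    rw [← hL]
    simp only [Multiset.sum_cons]
    simp only [← Multiset.singleton_add]
    abel
  · obtain ⟨L₁, _, g₁, hr₁, rfl⟩ := Multiset.rel_cons_left.1 hr
    obtain ⟨L₂, T, g₂, hT, rfl⟩ := Multiset.rel_cons_left.1 hr₁
    obtain ⟨c₁, H, rfl, d⟩ := g₁
    obtain ⟨l, hl, hla, rfl⟩ := g₂
    obtain ⟨c, f, b, rfl, hc, rfl, rfl⟩ := P.eq_overR_of_absLink hla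
    cases hc
    have h' := P.expand_comp h
    rw [expand_pieces] at h'
    have ha : AbsRule σ P.label (.overR m c₁ f b) c₁ f b _ _ := .overR h'
    obtain ⟨K, rfl⟩ := d.exists_cons_of_absRule ha
    refine ⟨(_ ::ₘ L₁) ::ₘ T, hT.cons ⟨f, K, rfl, .abs ha (P.isInstance _ hl) d⟩, ?_⟩
    rw [← hL]
    simp only [Multiset.sum_cons]
    simp only [← Multiset.singleton_add]
    abel
  · obtain ⟨L₁, _, g₁, hr₁, rfl⟩ := Multiset.rel_cons_left.1 hr
    obtain ⟨L₂, T, g₂, hT, rfl⟩ := Multiset.rel_cons_left.1 hr₁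
    obtain ⟨c, H, rfl, d⟩ := g₁
    obtain ⟨l, hl, hla, rfl⟩ := g₂
    obtain ⟨p, a, b, rfl, rfl, rfl, rfl⟩ := P.eq_prodL_of_absLink hla
    have h' := P.expand_comp h
    rw [expand_pieces, expand_pieces] at h'
    rw [expand_append, expand_append] at d
    obtain ⟨K, rfl⟩ : ∃ K, H = a ::ₘ b ::ₘ K := by
      have hle : lettersOf σ P.label (a ::ₘ {b}) ≤ lettersOf σ P.label H := by
        rw [← d.vars, Str.vars_append, Str.vars_append, h'.vars, vars_occString, vars_occString,
          add_right_comm]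
        refine le_trans (le_of_eq ?_) (Multiset.le_add_left _ _)
        simp [lettersOf]
      obtain ⟨K, rfl⟩ := Multiset.le_iff_exists_add.1 (le_of_lettersOf_le hle)
      exact ⟨K, by simp [← Multiset.singleton_add, add_assoc]⟩
    have hp : (P.label p).WF σ := P.wf p (P.mem_verts _ hl p (by simp [Link.prems]))
    refine ⟨(.prodL m p a b ::ₘ (0 + L₁)) ::ₘ T, hT.cons ⟨c, {p} + K, rfl, ?_⟩, ?_⟩
    · rw [expand_append, expand_node_cons, ← List.append_assoc]
      exact .prodE (P.isInstance _ hl) (.ax p hp) d h'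
    · rw [← hL]
      simp only [Multiset.sum_cons]
      simp only [← Multiset.singleton_add, zero_add]
      abel

lemma justified_absLink {l : Link V} (hl : l ∈ P.links) : P.Justified (P.absLink l) {l} := by
  have ht {m : Mode} {x y z : V} (ht : l.IsTensor m x y z) : P.Justified (P.absLink l) {l} := by
    have hxy : ∀ v ∈ l.prems, (P.label v).WF σ := fun v hv =>
      P.wf v (P.mem_verts l hl v (by simp [hv]))
    have hx : x ∈ (l.prems : Multiset V) := by simp [ht.prems]
    have hy : y ∈ (l.prems : Multiset V) := by simp [ht.prems]
    cases m with
    | concat =>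
      rw [ht.absLink P]
      refine ⟨z, {x} + {y}, rfl, ?_⟩
      refine (Deriv.tensor ht (P.isInstance l hl) (.ax x (hxy x hx)) (.ax y (hxy y hy))
        (ω := P.expand [.var (.node x), .var (.node y)]) ?_).of_eq rfl rfl rfl
      rw [expand_node_cons, expand_node_cons, expand_nil, List.append_nil]
      exact rfl
    | wrap k =>
      have h := ht.absLink P
      rw [h]
      exact ⟨l, hl, h, rfl⟩
  cases l with
  | overL m f b c => exact ht (.overL m f b c)
  | underL m a f c => exact ht (.underL m a f c)
  | prodR m a b p => exact ht (.prodR m a b p)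
  | overR | underR | prodL => exact ⟨_, hl, rfl, rfl⟩

variable [DecidableEq V]

lemma allJustified_abstract : P.AllJustified P.abstract := by
  refine ⟨P.links.val.map (fun l => {l}) + P.inputs.val.map fun _ => 0, ?_, by simp⟩
  refine Multiset.Rel.add (Multiset.rel_map.2 (Multiset.rel_refl_of_refl_on fun l hl => ?_))
    (Multiset.rel_map.2 (Multiset.rel_refl_of_refl_on fun v hv => ⟨v, {v}, rfl, ?_⟩))
  · exact P.justified_absLink hl
  · rw [expand_pieces]
    refine .ax v (P.wf v ?_)
    rcases Finset.mem_union.1 hv with hv | hv <;> exact (Finset.mem_filter.1 hv).1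

/-- If the abstract proof structure of `P` contracts to a single comb, then all of `P` comes from
one derivation, the string of which is the list of premisses of the comb. -/
lemma ContractsTo.exists_deriv {P : ProofStructure σ V} {ω : Str (AVert V)} {w : AVert V}
    (h : P.ContractsTo ω w) :
    ∃ (c : V) (ω' : Str (V × ℕ)), w = .node c ∧ ω = toVert ω' ∧
      P.verts.val = c ::ₘ Link.premsOf P.links.val ∧
      Deriv σ P.label False P.hyps.val ω' c P.links.val := by
  have hj : P.AllJustified {.comb ω w} := by
    have := h.1
    generalize ({.comb ω w} : Multiset (ALink (AVert V))) = M at this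
    induction this with
    | refl => exact P.allJustified_abstract
    | tail _ hs ih => exact ih.step P hs
  obtain ⟨Ls, hr, hL⟩ := hj
  obtain ⟨L, T, ⟨c, H, rfl, d⟩, hT, rfl⟩ := Multiset.rel_cons_left.1 hr
  rw [Multiset.rel_zero_left] at hT
  subst hT
  rw [Multiset.sum_cons, Multiset.sum_zero, add_zero] at hL
  subst hL
  obtain ⟨hω, hv⟩ := h.verts_eq
  have hH : H = P.hyps.val := by
    refine add_right_cancel (b := Link.conclsOf P.links.val) ?_
    rw [d.balance, P.hyps_add_concls, hv]
  subst hH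
  exact ⟨c, P.expand ω, rfl, (P.toVert_expand hω).symm, hv,
    d.subst_elim (hv ▸ P.verts.nodup)⟩

end ProofStructure

end

section
variable {At : Type*} {σ : At → ℕ}

/-! ### Every natural deduction proof has a proof structure -/

lemma ND.nodup_names {Γ : Multiset (ℕ × Formula At)} {γ : Str Letter} {C : Formula At}
    (d : ND σ Γ γ C) : (names Γ).Nodup := by
  induction d with
  | ax => exact Multiset.nodup_singleton _
  | overE m d₁ d₂ hd h ih₁ ih₂ | underE m d₁ d₂ hd h ih₁ ih₂ | prodI m d₁ d₂ hd h ih₁ ih₂ =>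
    rw [names, Multiset.map_add]
    exact Multiset.nodup_add.2 ⟨ih₁, ih₂, hd⟩
  | overI m x d h ih | underI m x d h ih =>
    rw [names, Multiset.map_cons] at ih
    exact (Multiset.nodup_cons.1 ih).2
  | prodE m x y d₁ d₂ hd h ih₁ ih₂ =>
    rw [names, Multiset.map_cons, Multiset.map_cons] at ih₂
    rw [names, Multiset.map_add]
    exact Multiset.nodup_add.2
      ⟨ih₁, (Multiset.nodup_cons.1 (Multiset.nodup_cons.1 ih₂).2).2, hd⟩

/-- `Places label Γ f S`: the hypotheses `Γ` can be placed at the occurrences `f x`, which are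
different from each other and from those in `S`. -/
structure Places (label : ℕ → Formula At) (Γ : Multiset (ℕ × Formula At)) (f : ℕ → ℕ)
    (S : Finset ℕ) : Prop where
  inj : ∀ x ∈ names Γ, ∀ y ∈ names Γ, f x = f y → x = y
  label_eq : ∀ p ∈ Γ, label (f p.1) = p.2
  notMem : ∀ x ∈ names Γ, f x ∉ S

/-- The proof structure of `d` can be built, with given places of the hypotheses and avoiding a
given finite set of occurrences, whenever each formula in `F` labels infinitely many
occurrences. -/
def Realizable {Γ : Multiset (ℕ × Formula At)} {γ : Str Letter} {C : Formula At}
    (d : ND σ Γ γ C) (F : Set (Formula At)) : Prop :=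
  ∀ label : ℕ → Formula At, (∀ A ∈ F, {n | label n = A}.Infinite) →
    ∀ (f : ℕ → ℕ) (S : Finset ℕ), Places label Γ f S →
      ∃ vs ls c, d.Corresponds label vs ls f c ∧ Disjoint vs S

lemma Places.cons {label : ℕ → Formula At} {Γ : Multiset (ℕ × Formula At)} {f : ℕ → ℕ}
    {S : Finset ℕ} (h : Places label Γ f S) {x b : ℕ} {B : Formula At} (hx : x ∉ names Γ)
    (hb : label b = B) (hb' : b ∉ S ∪ (names Γ).toFinset.image f) :
    Places label ((x, B) ::ₘ Γ) (Function.update f x b) S := by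
  simp only [Finset.mem_union, not_or, Finset.mem_image, Multiset.mem_toFinset, not_exists,
    not_and] at hb'
  have hf : ∀ y ∈ names Γ, Function.update f x b y = f y := fun y hy =>
    Function.update_of_ne (fun e : y = x => hx (e ▸ hy)) _ _
  have hn : names ((x, B) ::ₘ Γ) = x ::ₘ names Γ := Multiset.map_cons _ _ _
  refine ⟨fun y hy z hz e => ?_, fun p hp => ?_, fun y hy => ?_⟩
  · rw [hn, Multiset.mem_cons] at hy hz
    rcases hy with rfl | hy <;> rcases hz with rfl | hz
    · rfl
    · rw [Function.update_self, hf z hz] at e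
      exact (hb'.2 z hz e.symm).elim
    · rw [Function.update_self, hf y hy] at e
      exact (hb'.2 y hy e).elim
    · rw [hf y hy, hf z hz] at e
      exact h.inj y hy z hz e
  · rcases Multiset.mem_cons.1 hp with rfl | hp
    · rwa [Function.update_self]
    · rw [hf _ (Multiset.mem_map_of_mem _ hp)]
      exact h.label_eq p hp
  · rw [hn, Multiset.mem_cons] at hy
    rcases hy with rfl | hy
    · rw [Function.update_self]
      exact hb'.1
    · rw [hf y hy]
      exact h.notMem y hy

lemma Places.left {label : ℕ → Formula At} {Γ Δ : Multiset (ℕ × Formula At)} {f : ℕ → ℕ}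
    {S : Finset ℕ} (h : Places label (Γ + Δ) f S) (hd : Disjoint (names Γ) (names Δ)) :
    Places label Γ f (S ∪ (names Δ).toFinset.image f) := by
  have hn : ∀ {x}, x ∈ names (Γ + Δ) ↔ x ∈ names Γ ∨ x ∈ names Δ := by simp [names]
  refine ⟨fun x hx y hy => h.inj x (hn.2 (.inl hx)) y (hn.2 (.inl hy)),
    fun p hp => h.label_eq p (Multiset.mem_add.2 (.inl hp)), fun x hx hx' => ?_⟩
  rcases Finset.mem_union.1 hx' with hx' | hx'
  · exact h.notMem x (hn.2 (.inl hx)) hx'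
  · obtain ⟨y, hy, e⟩ := Finset.mem_image.1 hx'
    rw [Multiset.mem_toFinset] at hy
    exact Multiset.disjoint_left.1 hd hx (h.inj y (hn.2 (.inr hy)) x (hn.2 (.inl hx)) e ▸ hy)

lemma Places.right {label : ℕ → Formula At} {Γ Δ : Multiset (ℕ × Formula At)} {f : ℕ → ℕ}
    {S vs : Finset ℕ} (h : Places label (Γ + Δ) f S)
    (hvs : Disjoint vs (S ∪ (names Δ).toFinset.image f)) :
    Places label Δ f (S ∪ vs) := by
  have hn : ∀ {x}, x ∈ names (Γ + Δ) ↔ x ∈ names Γ ∨ x ∈ names Δ := by simp [names]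
  refine ⟨fun x hx y hy => h.inj x (hn.2 (.inr hx)) y (hn.2 (.inr hy)),
    fun p hp => h.label_eq p (Multiset.mem_add.2 (.inr hp)), fun x hx hx' => ?_⟩
  rcases Finset.mem_union.1 hx' with hx' | hx'
  · exact h.notMem x (hn.2 (.inr hx)) hx'
  · exact Finset.disjoint_left.1 hvs hx' (Finset.mem_union_right _
      (Finset.mem_image_of_mem _ (Multiset.mem_toFinset.2 hx)))

/-- Proof structures for two subproofs that are disjoint from each other and from `S`, with a
fresh conclusion. -/
lemma Realizable.pair {Γ Δ : Multiset (ℕ × Formula At)} {γ δ : Str Letter} {C D : Formula At}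
    {d₁ : ND σ Γ γ C} {d₂ : ND σ Δ δ D} {F₁ F₂ : Set (Formula At)} (h₁ : Realizable d₁ F₁)
    (h₂ : Realizable d₂ F₂) (hd : Disjoint (names Γ) (names Δ)) {label : ℕ → Formula At}
    {E : Formula At} (hF : ∀ A ∈ insert E (F₁ ∪ F₂), {n | label n = A}.Infinite) {f : ℕ → ℕ}
    {S : Finset ℕ} (h : Places label (Γ + Δ) f S) :
    ∃ vs₁ ls₁ c₁ vs₂ ls₂ c₂ c, d₁.Corresponds label vs₁ ls₁ f c₁ ∧
      d₂.Corresponds label vs₂ ls₂ f c₂ ∧ Disjoint vs₁ vs₂ ∧ c ∉ vs₁ ∪ vs₂ ∧ label c = E ∧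
      Disjoint (insert c (vs₁ ∪ vs₂)) S := by
  obtain ⟨vs₁, ls₁, c₁, hc₁, hv₁⟩ := h₁ label (fun A hA => hF A (by simp [hA])) f _ (h.left hd)
  obtain ⟨vs₂, ls₂, c₂, hc₂, hv₂⟩ := h₂ label (fun A hA => hF A (by simp [hA])) f _ (h.right hv₁)
  obtain ⟨c, hc, hc'⟩ := (hF E (by simp)).exists_notMem_finset (S ∪ (vs₁ ∪ vs₂))
  rw [Finset.mem_union, not_or] at hc'
  rw [Finset.disjoint_union_right] at hv₁ hv₂
  exact ⟨vs₁, ls₁, c₁, vs₂, ls₂, c₂, c, hc₁, hc₂, hv₂.2.symm, hc'.2, hc,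
    Finset.disjoint_insert_left.2 ⟨hc'.1, Finset.disjoint_union_left.2 ⟨hv₁.1, hv₂.1⟩⟩⟩

/-- A proof structure for a subproof in which the withdrawn hypothesis is a fresh occurrence,
with a fresh conclusion. -/
lemma Realizable.withdraw {Γ : Multiset (ℕ × Formula At)} {γ : Str Letter} {B C : Formula At}
    {x : ℕ} {d : ND σ ((x, B) ::ₘ Γ) γ C} {F : Set (Formula At)} (h : Realizable d F)
    {label : ℕ → Formula At} {E : Formula At}
    (hF : ∀ A ∈ insert E (insert B F), {n | label n = A}.Infinite) {f : ℕ → ℕ} {S : Finset ℕ}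
    (hf : Places label Γ f S) :
    ∃ vs ls c' b c, d.Corresponds label vs ls (Function.update f x b) c' ∧ c ∉ vs ∧
      label c = E ∧ Disjoint (insert c vs) S := by
  have hx : x ∉ names Γ := by
    have := d.nodup_names
    rw [names, Multiset.map_cons] at this
    exact (Multiset.nodup_cons.1 this).1
  obtain ⟨b, hb, hb'⟩ := (hF B (by simp)).exists_notMem_finset (S ∪ (names Γ).toFinset.image f)
  obtain ⟨vs, ls, c', hc', hv⟩ := h label (fun A hA => hF A (by simp [hA])) _ S
    (hf.cons hx hb hb')
  obtain ⟨c, hc, hcv⟩ := (hF E (by simp)).exists_notMem_finset (S ∪ vs)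
  rw [Finset.mem_union, not_or] at hcv
  exact ⟨vs, ls, c', b, c, hc', hcv.2, hc, Finset.disjoint_insert_left.2 ⟨hcv.1, hv⟩⟩

/-- Only the countably many formulas in `F` are needed for the new occurrences. -/
lemma ND.exists_realizable {Γ : Multiset (ℕ × Formula At)} {γ : Str Letter} {C : Formula At}
    (d : ND σ Γ γ C) : ∃ F : Set (Formula At), F.Countable ∧ Realizable d F := by
  induction d with
  | ax x A hA =>
    refine ⟨∅, Set.countable_empty, fun label _ f S h => ⟨{f x}, ∅, f x, ⟨rfl, rfl, rfl, ?_⟩, ?_⟩⟩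
    · exact h.label_eq (x, A) (by simp)
    · exact Finset.disjoint_singleton_left.2 (h.notMem x (by simp [names]))
  | @overE _ _ _ _ _ C B m d₁ d₂ hd h ih₁ ih₂ =>
    obtain ⟨F₁, hF₁, h₁⟩ := ih₁
    obtain ⟨F₂, hF₂, h₂⟩ := ih₂
    refine ⟨_, (hF₁.union hF₂).insert C, fun label hF f S hf => ?_⟩
    obtain ⟨vs₁, ls₁, c₁, vs₂, ls₂, c₂, c, h₁, h₂, hv, hc, hl, hS⟩ := h₁.pair h₂ hd hF hf
    exact ⟨_, _, c, ⟨vs₁, vs₂, ls₁, ls₂, c₁, c₂, h₁, h₂, hv, hc, hl, rfl, rfl⟩, hS⟩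
  | @underE _ _ _ _ _ A C m d₁ d₂ hd h ih₁ ih₂ =>
    obtain ⟨F₁, hF₁, h₁⟩ := ih₁
    obtain ⟨F₂, hF₂, h₂⟩ := ih₂
    refine ⟨_, (hF₁.union hF₂).insert C, fun label hF f S hf => ?_⟩
    obtain ⟨vs₁, ls₁, c₁, vs₂, ls₂, c₂, c, h₁, h₂, hv, hc, hl, hS⟩ := h₁.pair h₂ hd hF hf
    exact ⟨_, _, c, ⟨vs₁, vs₂, ls₁, ls₂, c₁, c₂, h₁, h₂, hv, hc, hl, rfl, rfl⟩, hS⟩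
  | @prodI _ _ _ _ _ A B m d₁ d₂ hd h ih₁ ih₂ =>
    obtain ⟨F₁, hF₁, h₁⟩ := ih₁
    obtain ⟨F₂, hF₂, h₂⟩ := ih₂
    refine ⟨_, (hF₁.union hF₂).insert (.prod m A B), fun label hF f S hf => ?_⟩
    obtain ⟨vs₁, ls₁, c₁, vs₂, ls₂, c₂, c, h₁, h₂, hv, hc, hl, hS⟩ := h₁.pair h₂ hd hF hf
    exact ⟨_, _, c, ⟨vs₁, vs₂, ls₁, ls₂, c₁, c₂, h₁, h₂, hv, hc, hl, rfl, rfl⟩, hS⟩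
  | @overI _ _ _ C B m x d h ih =>
    obtain ⟨F, hF, h⟩ := ih
    refine ⟨_, (hF.insert B).insert (.over m C B), fun label hF f S hf => ?_⟩
    obtain ⟨vs, ls, c', b, c, h, hc, hl, hS⟩ := h.withdraw hF hf
    exact ⟨_, _, c, ⟨vs, ls, c', b, h, hc, hl, rfl, rfl⟩, hS⟩
  | @underI _ _ _ A C m x d h ih =>
    obtain ⟨F, hF, h⟩ := ih
    refine ⟨_, (hF.insert A).insert (.under m A C), fun label hF f S hf => ?_⟩
    obtain ⟨vs, ls, c', b, c, h, hc, hl, hS⟩ := h.withdraw hF hf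
    exact ⟨_, _, c, ⟨vs, ls, c', b, h, hc, hl, rfl, rfl⟩, hS⟩
  | @prodE Γ Δ δ γ₁ ζ γ₂ A B C m x y d₁ d₂ hd h ih₁ ih₂ =>
    obtain ⟨F₁, hF₁, h₁⟩ := ih₁
    obtain ⟨F₂, hF₂, h₂⟩ := ih₂
    refine ⟨insert A (insert B (F₁ ∪ F₂)), ((hF₁.union hF₂).insert _).insert _,
      fun label hF f S hf => ?_⟩
    obtain ⟨vs₁, ls₁, c₁, hc₁, hv₁⟩ := h₁ label (fun A hA => hF A (by simp [hA])) f _ (hf.left hd)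
    have hf₂ := hf.right hv₁
    have hn := d₂.nodup_names
    simp only [names, Multiset.map_cons, Multiset.nodup_cons, Multiset.mem_cons, not_or] at hn
    obtain ⟨⟨hxy, hx⟩, hy, -⟩ := hn
    obtain ⟨a, ha, ha'⟩ := (hF A (by simp)).exists_notMem_finset
      (S ∪ vs₁ ∪ (names Δ).toFinset.image f)
    have hfa := hf₂.cons hx ha ha'
    obtain ⟨b, hb, hb'⟩ := (hF B (by simp)).exists_notMem_finset
      (S ∪ vs₁ ∪ (names ((x, A) ::ₘ Δ)).toFinset.image (Function.update f x a))
    have hy' : y ∉ names ((x, A) ::ₘ Δ) := by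
      rw [names, Multiset.map_cons, Multiset.mem_cons, not_or]
      exact ⟨Ne.symm hxy, hy⟩
    have hfb := hfa.cons hy' hb hb'
    rw [Multiset.cons_swap] at hfb
    obtain ⟨vs₂, ls₂, c, hc₂, hv₂⟩ := h₂ label (fun A hA => hF A (by simp [hA])) _ _ hfb
    rw [Finset.disjoint_union_right] at hv₁ hv₂
    exact ⟨_, _, c, ⟨vs₁, vs₂, ls₁, ls₂, c₁, a, b, hc₁, hc₂, hv₂.2.symm, rfl, rfl⟩,
      Finset.disjoint_union_left.2 ⟨hv₁.1, hv₂.1⟩⟩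

/-- The proof structure whose occurrences and links are represented by a derivation. -/
def Represents.proofStructure {V : Type*} {label : V → Formula At} {H : Multiset V}
    {ω : Str (V × ℕ)} {c : V} {vs : Finset V} {ls : Finset (Link V)}
    (h : Represents σ label H ω c vs ls) : ProofStructure σ V where
  verts := vs
  label := label
  links := ls
  wf v hv := h.deriv.wf_sort.1 v (h.verts ▸ hv)
  mem_verts l hl v hv := (List.mem_append.1 hv).elim (h.mem_prems hl) (h.mem_concls hl)
  isInstance := h.deriv.isInstance
  prems_nodup := (Multiset.nodup_cons.1 h.nodup).2
  concls_nodup := by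
    have := h.nodup
    rw [← h.deriv.balance] at this
    exact (Multiset.nodup_add.1 this).2.1

lemma ND.exists_proofStructure {Γ : Multiset (ℕ × Formula At)} {γ : Str Letter} {C : Formula At}
    (d : ND σ Γ γ C) : ∃ (P : ProofStructure σ ℕ) (f : ℕ → ℕ) (c : ℕ),
      d.Corresponds P.label P.verts P.links f c := by
  classical
  obtain ⟨F, hF, hd⟩ := d.exists_realizable
  have hF' : (insert C (F ∪ {A | A ∈ Γ.map Prod.snd})).Countable :=
    (hF.union ((Γ.map Prod.snd).toFinset.countable_toSet.mono fun A hA => by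
      simpa using hA)).insert C
  -- a labelling in which every formula that is needed occurs infinitely often
  obtain ⟨e, he⟩ := hF'.exists_eq_range (Set.insert_nonempty _ _)
  have hidx : ∀ A ∈ F ∪ {A | A ∈ Γ.map Prod.snd}, ∃ k, e k = A := fun A hA => by
    have : A ∈ Set.range e := he ▸ Set.mem_insert_of_mem _ hA
    exact this
  have hΓ : ∀ x, ∃ k, ∀ p ∈ Γ, p.1 = x → e k = p.2 := fun x => by
    by_cases hx : x ∈ names Γ
    · obtain ⟨p, hp, rfl⟩ := Multiset.mem_map.1 hx
      obtain ⟨k, hk⟩ := hidx p.2 (.inr (Multiset.mem_map_of_mem _ hp))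
      refine ⟨k, fun q hq hqp => ?_⟩
      rw [hk, Multiset.inj_on_of_nodup_map d.nodup_names q hq p hp hqp]
    · exact ⟨0, fun p hp h => (hx (h ▸ Multiset.mem_map_of_mem _ hp)).elim⟩
  choose k hk using hΓ
  obtain ⟨vs, ls, c, hc, -⟩ := hd (fun n => e n.unpair.1) (fun A hA => by
      obtain ⟨i, rfl⟩ := hidx A (.inl hA)
      refine Set.infinite_of_injective_forall_mem (f := fun j : ℕ => Nat.pair i j)
        (fun j j' h => (Nat.pair_eq_pair.1 h).2) fun j => ?_
      simp)
    (fun x => Nat.pair (k x) x) ∅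
    ⟨fun x _ y _ h => (Nat.pair_eq_pair.1 h).2, fun p hp => by simpa using hk p.1 p hp rfl,
      by simp⟩
  exact ⟨hc.represents.1.proofStructure, _, c, hc⟩

end

/-! ### Proof nets and contractions -/

section
variable {At V : Type*} {σ : At → ℕ}

lemma vertString_eq (f : ℕ → V) (γ : Str Letter) :
    vertString f γ = toVert (Str.rename (fun p => (f p.1, p.2)) γ) := by
  rw [toVert, Str.rename_rename]
  rfl

namespace ProofStructure
variable [DecidableEq V] (P : ProofStructure σ V)

lemma conclusions_eq_of_verts_eq {c : V}
    (h : P.verts.val = c ::ₘ Link.premsOf P.links.val) : P.conclusions = {c} := by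
  refine Finset.val_injective (add_right_cancel (b := Link.premsOf P.links.val) ?_)
  rw [P.conclusions_add_prems, h]
  exact (Multiset.singleton_add _ _).symm

lemma soundness {Γ : Multiset (ℕ × Formula At)} {γ : Str Letter} {C : Formula At}
    {d : ND σ Γ γ C} {f : ℕ → V} {c : V} (h : d.Corresponds P.label P.verts P.links f c) :
    P.HasHyps Γ f ∧ P.conclusions = {c} ∧ P.label c = C ∧
      P.ContractsTo (vertString f γ) (.node c) := by
  obtain ⟨r, hC, hΓ⟩ := h.represents
  have hH : (Γ.map fun p => f p.1) = P.hyps.val := by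
    refine add_right_cancel (b := Link.conclsOf P.links.val) ?_
    rw [r.deriv.balance, P.hyps_add_concls, r.verts]
  refine ⟨?_, P.conclusions_eq_of_verts_eq r.verts, hC, ?_, ?_⟩
  · rw [HasHyps, ← hH, Multiset.map_map]
    exact Multiset.map_congr rfl fun p hp => by simp [hΓ p hp]
  · rw [P.abstract_eq, ← hH, vertString_eq]
    exact r.deriv.contracts P r.nodup
  · rw [vertString_eq]
    exact node_notMem_toVert _ _

lemma completeness {ω : Str (AVert V)} {w : AVert V} (h : P.ContractsTo ω w) :
    ∃ c : V, w = .node c ∧ P.conclusions = {c} ∧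
      ∀ (Γ : Multiset (ℕ × Formula At)) (f : ℕ → V), P.HasHyps Γ f →
        ∃ (γ : Str Letter) (d : ND σ Γ γ (P.label c)),
          d.Corresponds P.label P.verts P.links f c ∧ vertString f γ = ω := by
  obtain ⟨c, ω, rfl, rfl, hv, d⟩ := h.exists_deriv
  refine ⟨c, rfl, P.conclusions_eq_of_verts_eq hv, fun Γ f hΓ => ?_⟩
  have hmap : (Γ.map fun p => f p.1) = P.hyps.val := by
    have := congrArg (Multiset.map Prod.fst) hΓ
    simpa only [Multiset.map_map, Function.comp_def, Multiset.map_id'] using this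
  -- `x v` is the name of the hypothesis `v`
  have hname : ∀ v, ∃ x, v ∈ P.hyps.val → ∃ p ∈ Γ, f p.1 = v ∧ p.1 = x := fun v => by
    by_cases hv : v ∈ P.hyps.val
    · obtain ⟨p, hp, hpv⟩ := Multiset.mem_map.1 (hmap ▸ hv)
      exact ⟨p.1, fun _ => ⟨p, hp, hpv, rfl⟩⟩
    · exact ⟨0, fun h => (hv h).elim⟩
  choose x hx using hname
  have hfx : ∀ v ∈ P.hyps.val, f (x v) = v := fun v hv => by
    obtain ⟨p, -, hpv, hpx⟩ := hx v hv
    rw [← hpx, hpv]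
  have hxf : ∀ p ∈ Γ, x (f p.1) = p.1 := fun p hp => by
    obtain ⟨q, hq, hqp, hqx⟩ := hx (f p.1) (hmap ▸ Multiset.mem_map_of_mem (fun p => f p.1) hp)
    rw [← hqx, Multiset.inj_on_of_nodup_map (hmap ▸ P.hyps.nodup) q hq p hp hqp]
  have hΓ' : Γ = P.hyps.val.map fun v => (x v, P.label v) := by
    have := congrArg (Multiset.map fun q : V × Formula At => (x q.1, q.2)) hΓ
    simp only [Multiset.map_map, Function.comp_def] at this
    rw [← this]
    conv_lhs => rw [← Multiset.map_id' Γ]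
    exact Multiset.map_congr rfl fun p hp => by rw [hxf p hp]
  obtain ⟨Γ₀, γ, C, e, rfl, rfl, rfl, hc⟩ := d.exists_nd (hv ▸ P.verts.nodup) x f hfx
  subst hΓ'
  refine ⟨_, e, ?_, ?_⟩
  · rw [← hv] at hc
    simpa using hc
  · rw [vertString_eq, Str.rename_rename, Str.rename_eq_self]
    rintro ⟨v, i⟩ hp
    simp [hfx v (d.mem_hyps_of_mem hp)]

lemma exists_hasHyps (hP : P.verts.Nonempty) : ∃ Γ f, P.HasHyps Γ f := by
  obtain ⟨v₀, -⟩ := hP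
  refine ⟨P.hyps.val.map fun v => (P.hyps.toList.idxOf v, P.label v),
    fun n => P.hyps.toList.getD n v₀, ?_⟩
  rw [HasHyps, Multiset.map_map]
  refine Multiset.map_congr rfl fun v hv => ?_
  have : P.hyps.toList.idxOf v < P.hyps.toList.length :=
    List.idxOf_lt_length_iff.2 (Finset.mem_toList.2 hv)
  simp [List.getElem?_eq_getElem this]

end ProofStructure

end

end Displacement

theorem mainTheorem1 {At V : Type*} [DecidableEq V] (σ : At → ℕ) :
    -- a proof structure is a proof net iff its abstract proof structure contracts to a comb
    (∀ P : ProofStructure σ V, P.IsProofNet ↔ P.ContractsToComb) ∧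
    -- every natural deduction proof corresponds to some proof structure
    (∀ (Γ : Multiset (ℕ × Formula At)) (γ : Str Letter) (C : Formula At) (d : ND σ Γ γ C),
      ∃ (P : ProofStructure σ ℕ) (f : ℕ → ℕ) (c : ℕ),
        d.Corresponds P.label P.verts P.links f c) ∧
    -- soundness: it has the same hypotheses and conclusion and contracts to the comb of `γ : C`
    (∀ (P : ProofStructure σ V) (Γ : Multiset (ℕ × Formula At)) (γ : Str Letter)
      (C : Formula At) (d : ND σ Γ γ C) (f : ℕ → V) (c : V),
      d.Corresponds P.label P.verts P.links f c →
        P.HasHyps Γ f ∧ P.conclusions = {c} ∧ P.label c = C ∧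
          P.ContractsTo (vertString f γ) (.node c)) ∧
    -- completeness: if `P` contracts to a comb, then there is a natural deduction proof
    -- corresponding to `P`, from the hypotheses of `P` and with the string term of the comb
    (∀ (P : ProofStructure σ V) (ω : Str (AVert V)) (w : AVert V), P.ContractsTo ω w →
      ∃ c : V, w = .node c ∧ P.conclusions = {c} ∧
        ∀ (Γ : Multiset (ℕ × Formula At)) (f : ℕ → V), P.HasHyps Γ f →
          ∃ (γ : Str Letter) (d : ND σ Γ γ (P.label c)),
            d.Corresponds P.label P.verts P.links f c ∧ vertString f γ = ω) := by
  refine ⟨fun P => ⟨?_, ?_⟩, fun Γ γ C d => d.exists_proofStructure,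
    fun P Γ γ C d f c h => P.soundness h, fun P ω w h => P.completeness h⟩
  · rintro ⟨Γ, γ, C, d, f, c, h⟩
    exact ⟨_, _, (P.soundness h).2.2.2⟩
  · rintro ⟨ω, w, h⟩
    obtain ⟨c, -, hc, hd⟩ := P.completeness h
    have hP : c ∈ P.verts :=
      (Finset.mem_filter.1 (hc ▸ Finset.mem_singleton_self c : c ∈ P.conclusions)).1
    obtain ⟨Γ, f, hf⟩ := P.exists_hasHyps ⟨c, hP⟩
    obtain ⟨γ, d, hcor, -⟩ := hd Γ f hf
    exact ⟨Γ, γ, _, d, f, c, hcor⟩
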